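/- Let $\mathbb D=\{z\in\mathbb C:|z|<1\}$. For $c\in(0,2]$ let $k_c(z)=\frac1{2c}\left[\left(\frac{1+z}{1-z}\right)^c-1\right]$ and let $k_0(z)=\frac12\log\frac{1+z}{1-z}$ (principal branches). Let $n\ge 1$ be an integer. For every $c\in[0,2]$ there are functions $h_{c,n},g_{c,n}$, analytic in $\mathbb D$, with $$h_{c,n}(0)=g_{c,n}(0)=0,\qquad h_{c,n}-g_{c,n}=k_c,\qquad g_{c,n}'(z)=z^n h_{c,n}'(z)\quad(z\in\mathbb D),$$ and, for any such functions, the harmonic mappings $f_{c,n}=h_{c,n}+\overline{g_{c,n}}$ have the following properties. 1. For every $c\in[0,2]$, $f_{c,n}\in\mathcal S_H^0$, that is, $f_{c,n}$ is univalent in $\mathbb D$, $|h_{c,n}'|^2-|g_{c,n}'|^2>0$ in $\mathbb D$, $h_{c,n}'(0)=1$ and $g_{c,n}'(0)=0$; and $f_{c,n}(\mathbb D)$ is a domain that is convex in the horizontal direction, i.e. its intersection with each horizontal line is connected or empty. 2. As $c$ varies from $0$ to $2$, the mapping changes continuously from a mapping onto a strip to a mapping onto a wave plane and then to a mapping onto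 a slit domain. Precisely: * $(c,z)\mapsto f_{c,n}(z)$ is continuous on $[0,2]\times\mathbb D$; * $f_{0,n}(\mathbb D)$ is the strip $\{|\operatorname{Im}w|<\pi/4\}$ if $n$ is even, and a half-strip $\{|\operatorname{Im}w|<\pi/4,\ \operatorname{Re}w>a\}$ with some $a\in\mathbb R$ if $n$ is odd; * for $0<c<2$, $f_{c,n}(\mathbb D)$ is a wave plane in the following sense: let $E_{c,n}$ be the finite set of the heights $\pm\frac{1}{2c}\sin\frac{c\pi}2\,\cot^c\frac{k\pi}n$ with integers $1\le k<n/2$, together with the height $0$ if $n$ is even and $c\le1$; then there is a function $\varphi:\mathbb R\to\mathbb R$, continuous on $\mathbb R\setminus E_{c,n}$, with $\varphi(v)\to-\infty$ as $v\to e$, $v\ne e$, for each $e\in E_{c,n}$, and as $v\to\pm\infty$, such that $$f_{c,n}(\mathbb D)=\{u+iv:\ v\in E_{c,n}\ \text{or}\ u>\varphi(v)\};$$ * $f_{2,n}(\mathbb D)=\mathbb C\setminus(-\infty,a]$ for some $a\in\mathbb R$. 3. If $n$ is even then, for every $c\in[0,2]$, $f_{c,n}$ lifts to a minimal surface: there is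 a function $F:f_{c,n}(\mathbb D)\to\mathbb R$, smooth and satisfying the minimal surface equation $$(1+F_v^2)F_{uu}-2F_uF_vF_{uv}+(1+F_u^2)F_{vv}=0$$ on the open set $f_{c,n}(\mathbb D)$, such that $z=x+iy\mapsto\big(\operatorname{Re}f_{c,n}(z),\operatorname{Im}f_{c,n}(z),F(f_{c,n}(z))\big)$ is a smooth regular parametrization of its graph over $\mathbb D$ by isothermal parameters, and $$F(f_{c,n}(z))=2\operatorname{Im}\int_0^z\zeta^{n/2}h_{c,n}'(\zeta)\,d\zeta\qquad(z\in\mathbb D).$$ -/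

import Mathlib

open Real Set Filter Topology
open scoped ContDiff ComplexConjugate

noncomputable section

/-- The open unit disk. -/
def disk : Set ℂ := Metric.ball 0 1

/-- The generalized Koebe function `k_c`; the value at `c = 0` is the limiting case.
On the disk, `(1+z)/(1-z)` lies in the right half-plane, where the principal branches of the power
and of the logarithm are analytic. -/
def koebe (c : ℝ) (z : ℂ) : ℂ :=
  if c = 0 then (1 / 2) * Complex.log ((1 + z) / (1 - z))
  else (1 / (2 * (c : ℂ))) * (((1 + z) / (1 - z)) ^ (c : ℂ) - 1)

/-- The harmonic mapping `h + conj g`. -/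
def harmonicMap (h g : ℂ → ℂ) (z : ℂ) : ℂ := h z + conj (g z)

/-- `h` and `g` are the analytic and co-analytic part of the shear of `φ` with dilatation `q`:
both are analytic in the disk, vanish at `0`, and satisfy `h - g = φ`, `g' = q h'`. -/
structure IsShear (φ q h g : ℂ → ℂ) : Prop where
  analytic_h : DifferentiableOn ℂ h disk
  analytic_g : DifferentiableOn ℂ g disk
  h_zero : h 0 = 0
  g_zero : g 0 = 0
  sub_eq : ∀ z ∈ disk, h z - g z = φ z
  dilatation : ∀ z ∈ disk, deriv g z = q z * deriv h z

/-- `h + conj g` belongs to the class `S_H^0`: normalized, sense-preserving, univalent harmonic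
mappings of the disk (`g'(0) = 0` says that the `z̄`-derivative vanishes at `0`). -/
structure IsSH0 (h g : ℂ → ℂ) : Prop where
  analytic_h : DifferentiableOn ℂ h disk
  analytic_g : DifferentiableOn ℂ g disk
  h_zero : h 0 = 0
  g_zero : g 0 = 0
  deriv_h_zero : deriv h 0 = 1
  deriv_g_zero : deriv g 0 = 0
  jacobian_pos : ∀ z ∈ disk, 0 < ‖deriv h z‖ ^ 2 - ‖deriv g z‖ ^ 2
  univalent : InjOn (harmonicMap h g) disk

/-- A domain convex in the horizontal direction: its intersection with every horizontal line is
connected or empty. -/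
structure IsCHD (Ω : Set ℂ) : Prop where
  isOpen : IsOpen Ω
  isConnected : IsConnected Ω
  line : ∀ y : ℝ, IsPreconnected (Ω ∩ {w : ℂ | w.im = y})

/-- The horizontal strip `|Im w| < π/4`. -/
def strip : Set ℂ := {w | |w.im| < π / 4}

/-- The half-strip `|Im w| < π/4`, `Re w > a`. -/
def halfStrip (a : ℝ) : Set ℂ := {w | |w.im| < π / 4 ∧ a < w.re}

/-- The plane slit along the real ray `(-∞, a]`. -/
def slitDomain (a : ℝ) : Set ℂ := {w | ¬ (w.im = 0 ∧ w.re ≤ a)}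

/-- `Ω` is a wave plane with set of crevices `E`: it contains the whole horizontal line at each
of the finitely many heights in `E`; on every other horizontal line it is the open ray to the right
of a point `φ v + i v`, where `φ` is continuous off `E` and tends to `-∞` at each height in `E`
and as the height tends to `±∞`. So the boundary consists of `|E| + 1` disjoint curves (waves). -/
def IsWavePlane (E : Set ℝ) (Ω : Set ℂ) : Prop :=
  E.Finite ∧ ∃ φ : ℝ → ℝ,
    Ω = {w : ℂ | w.im ∈ E ∨ φ w.im < w.re} ∧
    ContinuousOn φ Eᶜ ∧
    (∀ e ∈ E, Tendsto φ (𝓝[≠] e) atBot) ∧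
    Tendsto φ atTop atBot ∧ Tendsto φ atBot atBot

/-- The heights `± sin(cπ/2) cot(kπ/n)^c / (2c)`, `1 ≤ k < n/2`, together with the height `0`
if `n` is even and `c ≤ 1`. -/
def waveHeights (c : ℝ) (n : ℕ) : Set ℝ :=
  {v | (∃ k : ℕ, 1 ≤ k ∧ 2 * k < n ∧
          |v| = Real.sin (c * π / 2) * Real.cot (k * π / n) ^ c / (2 * c)) ∨
       (Even n ∧ c ≤ 1 ∧ v = 0)}

/-- The partial derivative with respect to the real part of the variable. -/
def partialX {V : Type*} [NormedAddCommGroup V] [NormedSpace ℝ V] (F : ℂ → V) (z : ℂ) : V :=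
  fderiv ℝ F z 1

/-- The partial derivative with respect to the imaginary part of the variable. -/
def partialY {V : Type*} [NormedAddCommGroup V] [NormedSpace ℝ V] (F : ℂ → V) (z : ℂ) : V :=
  fderiv ℝ F z Complex.I

/-- The graph `{(u, v, F(u + iv)) : u + iv ∈ Ω}` is a minimal surface: `F` is smooth on the open
set `Ω` and satisfies the minimal surface equation (vanishing mean curvature) there. -/
structure IsMinimalGraph (Ω : Set ℂ) (F : ℂ → ℝ) : Prop where
  isOpen : IsOpen Ω
  smooth : ContDiffOn ℝ ∞ F Ω
  equation : ∀ w ∈ Ω,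
    (1 + partialY F w ^ 2) * partialX (partialX F) w
      - 2 * partialX F w * partialY F w * partialX (partialY F) w
      + (1 + partialX F w ^ 2) * partialY (partialY F) w = 0

/-- `X` is a regular parametrization over the disk by isothermal parameters `x + iy`. -/
structure IsIsothermal (X : ℂ → EuclideanSpace ℝ (Fin 3)) : Prop where
  smooth : ContDiffOn ℝ ∞ X disk
  regular : ∀ z ∈ disk, partialX X z ≠ 0
  norm_eq : ∀ z ∈ disk, ‖partialX X z‖ = ‖partialY X z‖
  orthogonal : ∀ z ∈ disk, inner ℝ (partialX X z) (partialY X z) = 0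

/-- The mapping `f` of the disk lifts to the minimal graph of `F` over `f(𝔻)`: the graph is
parametrized by isothermal parameters in the disk whose projection to the base plane is `f`. -/
structure IsMinimalLift (f : ℂ → ℂ) (F : ℂ → ℝ) : Prop where
  minimal : IsMinimalGraph (f '' disk) F
  isothermal : IsIsothermal (fun z => !₂[(f z).re, (f z).im, F (f z)])

end

/-! The Cayley transform P = (1+z)/(1-z) carries the disk to the right half-plane, where `k_c`
becomes (P^c - 1)/(2c), or (log P)/2 for c = 0. Since Re(h + conj g) = Re(h + g) and Im(h + conj g)
= Im(h - g) = Im k_c, the map shears the range of `k_c` horizontally: in the coordinate w = k_c the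
height stays fixed and the horizontal coordinate is Re Φ with Φ = h + g. By
`IsShearSum.hasDerivAt_comp_powJ`, dΦ/dw is the kernel (1+z^n)/(1-z^n), whose real part is positive.
The range of `k_c` is a strip, a region bounded by two rays from a vertex, or a slit plane, and
meets each horizontal line in an interval. On that interval Re Φ is strictly increasing, which gives
univalence and horizontal convexity, and the image of f is found slice by slice from the limits of
Re Φ at the ends of the interval.

These limits come from the poles of the kernel on the boundary. The Cauchy-Schwarz bound
`re_cayley_le_re_cayley_pow`, rotated to an arbitrary pole in `re_inv_sub_le_re_herglotz`, bounds
the kernel below by a single pole. The pole at P = ∞ forces +∞ at every right end. For 0 < c < 2 the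
left end of a slice is a point b of the imaginary axis. If b is not a pole, Φ' is bounded near b and
the limit is finite; at a pole b ≠ 0 the kernel is at least δ/(s - a), and Re Φ falls
logarithmically to -∞. At b = 0 there is a pole only for even n; then Φ' behaves like P^(c-2), and
the limit is finite exactly when c > 1. Solving for the poles i·cot(kπ/n) and mapping them by `k_c`
gives the crevice heights. The boundary function tends to -∞ at ±∞ because Φ grows like P^(c+1),
which is driven to the left along suitable rays. For c = 0 and c = 2 the left ends are examined
directly.

Continuity in c follows by integrating h' and g' along radii. For even n the dilatation is the
square of z^(n/2); the Weierstrass representation then gives the surface, and applying ∂/∂z̄ to the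
chain rule identity for F ∘ f yields the minimal surface equation. -/

noncomputable section

/-! ### Growth, images and boundary limits of functions with controlled derivative. -/

theorem monotoneOn_sub_of_hasDerivAt_le {I : Set ℝ} (hI : Convex ℝ I) (hIo : IsOpen I)
    {F G F' G' : ℝ → ℝ} (hF : ∀ s ∈ I, HasDerivAt F (F' s) s)
    (hG : ∀ s ∈ I, HasDerivAt G (G' s) s) (hle : ∀ s ∈ I, G' s ≤ F' s) :
    MonotoneOn (fun s => F s - G s) I := by
  have hd : ∀ s ∈ I, HasDerivAt (fun s => F s - G s) (F' s - G' s) s :=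
    fun s hs => (hF s hs).sub (hG s hs)
  refine monotoneOn_of_deriv_nonneg hI (fun s hs => (hd s hs).continuousAt.continuousWithinAt)
    (fun s hs => ?_) (fun s hs => ?_)
  · rw [hIo.interior_eq] at hs
    exact (hd s hs).differentiableAt.differentiableWithinAt
  · rw [hIo.interior_eq] at hs
    rw [(hd s hs).deriv]
    linarith [hle s hs]

theorem strictMonoOn_of_hasDerivAt_pos {I : Set ℝ} (hI : Convex ℝ I) (hIo : IsOpen I)
    {F F' : ℝ → ℝ} (hF : ∀ s ∈ I, HasDerivAt F (F' s) s) (hpos : ∀ s ∈ I, 0 < F' s) :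
    StrictMonoOn F I := by
  refine strictMonoOn_of_deriv_pos hI (fun s hs => (hF s hs).continuousAt.continuousWithinAt)
    (fun s hs => ?_)
  rw [hIo.interior_eq] at hs
  rw [(hF s hs).deriv]
  exact hpos s hs

theorem tendsto_atTop_of_le_hasDerivAt {F F' : ℝ → ℝ} {a δ : ℝ} (hδ : 0 < δ)
    (hF : ∀ s ∈ Ioi a, HasDerivAt F (F' s) s) (hle : ∀ s ∈ Ioi a, δ ≤ F' s) :
    Tendsto F atTop atTop := by
  have hm := monotoneOn_sub_of_hasDerivAt_le (convex_Ioi a) isOpen_Ioi hF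
    (G := fun s => δ * s) (G' := fun _ => δ)
    (fun s _ => by simpa using (hasDerivAt_id s).const_mul δ) hle
  refine tendsto_atTop_mono' atTop (f₁ := fun s => δ * s + (F (a + 1) - δ * (a + 1))) ?_
    (tendsto_atTop_add_const_right _ _ (tendsto_id.const_mul_atTop hδ))
  filter_upwards [eventually_ge_atTop (a + 1)] with s hs
  have := hm (a := a + 1) (b := s) (by simp) (by simp only [mem_Ioi]; linarith) hs
  simp only at this
  linarith

theorem tendsto_atBot_of_le_hasDerivAt {F F' : ℝ → ℝ} {a δ : ℝ} (hδ : 0 < δ)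
    (hF : ∀ s ∈ Iio a, HasDerivAt F (F' s) s) (hle : ∀ s ∈ Iio a, δ ≤ F' s) :
    Tendsto F atBot atBot := by
  have hm := monotoneOn_sub_of_hasDerivAt_le (convex_Iio a) isOpen_Iio hF
    (G := fun s => δ * s) (G' := fun _ => δ)
    (fun s _ => by simpa using (hasDerivAt_id s).const_mul δ) hle
  refine tendsto_atBot_mono' atBot (f₁ := fun s => δ * s + (F (a - 1) - δ * (a - 1))) ?_
    (tendsto_atBot_add_const_right _ _ (tendsto_id.const_mul_atBot hδ))
  filter_upwards [eventually_le_atBot (a - 1)] with s hs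
  have := hm (a := s) (b := a - 1) (by simp only [mem_Iio]; linarith) (by simp) hs
  simp only at this
  linarith

/-- A derivative of at least `δ / (s - a)` forces logarithmic divergence at `a`. -/
theorem tendsto_nhdsGT_atBot_of_le_hasDerivAt {F F' : ℝ → ℝ} {a δ b : ℝ} (hδ : 0 < δ)
    (hab : a < b) (hF : ∀ s ∈ Ioo a b, HasDerivAt F (F' s) s)
    (hle : ∀ s ∈ Ioo a b, δ / (s - a) ≤ F' s) :
    Tendsto F (𝓝[>] a) atBot := by
  have hm := monotoneOn_sub_of_hasDerivAt_le (convex_Ioo a b) isOpen_Ioo hF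
    (G := fun s => δ * Real.log (s - a)) (G' := fun s => δ / (s - a))
    (fun s hs => by
      have := (((hasDerivAt_id s).sub_const a).log (by
        have := hs.1; simp only [id]; linarith)).const_mul δ
      simpa [div_eq_mul_inv] using this) hle
  have hc : (a + b) / 2 ∈ Ioo a b := ⟨by linarith, by linarith⟩
  set m := (a + b) / 2
  refine tendsto_atBot_mono' _
    (f₁ := fun s => δ * Real.log (s - a) + (F m - δ * Real.log (m - a))) ?_
    (tendsto_atBot_add_const_right _ _ (Tendsto.const_mul_atBot hδ
      (Real.tendsto_log_nhdsGT_zero.comp (f := fun s : ℝ => s - a) (x := 𝓝[>] a) ?_)))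
  · filter_upwards [Ioo_mem_nhdsGT hc.1] with s hs
    have := hm (a := s) (b := m) ⟨hs.1, hs.2.trans hc.2⟩ hc hs.2.le
    simp only at this
    linarith
  · refine tendsto_nhdsWithin_iff.2 ⟨?_, ?_⟩
    · have : Tendsto (fun s : ℝ => s - a) (𝓝 a) (𝓝 (a - a)) := tendsto_id.sub_const a
      rw [sub_self] at this
      exact this.mono_left nhdsWithin_le_nhds
    · filter_upwards [self_mem_nhdsWithin] with s hs
      simpa using hs

/-- A derivative of at least `δ / |s|` forces logarithmic divergence at `-∞`. -/
theorem tendsto_atBot_of_div_neg_le_hasDerivAt {F F' : ℝ → ℝ} {a δ : ℝ} (hδ : 0 < δ)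
    (ha : a ≤ 0) (hF : ∀ s ∈ Iio a, HasDerivAt F (F' s) s)
    (hle : ∀ s ∈ Iio a, δ / (-s) ≤ F' s) :
    Tendsto F atBot atBot := by
  have hm := monotoneOn_sub_of_hasDerivAt_le (convex_Iio a) isOpen_Iio hF
    (G := fun s => -(δ * Real.log (-s))) (G' := fun s => δ / (-s))
    (fun s hs => by
      have hs' : s < a := hs
      have := (((hasDerivAt_neg s)).log (by linarith)).const_mul δ
      refine this.neg.congr_deriv ?_
      rw [div_eq_mul_inv, div_eq_mul_inv]
      ring) hle
  refine tendsto_atBot_mono' _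
    (f₁ := fun s => -(δ * Real.log (-s)) + (F (a - 1) + δ * Real.log (-(a - 1)))) ?_
    (tendsto_atBot_add_const_right _ _ (tendsto_neg_atTop_atBot.comp (Tendsto.const_mul_atTop hδ
      (Real.tendsto_log_atTop.comp tendsto_neg_atBot_atTop))))
  filter_upwards [eventually_le_atBot (a - 1)] with s hs
  have := hm (a := s) (b := a - 1) (by simp only [mem_Iio]; linarith) (by simp) hs
  simp only at this
  linarith

/-- The range of a continuous function on a preconnected set that is unbounded above and tends to
its strict lower bound `ℓ` is the open ray above `ℓ`. -/
theorem image_eq_Ioi_of_tendsto {I : Set ℝ} (hI : IsPreconnected I) {F : ℝ → ℝ}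
    (hF : ContinuousOn F I) {l₁ l₂ : Filter ℝ} [l₁.NeBot] [l₂.NeBot] (h₁ : ∀ᶠ s in l₁, s ∈ I)
    (h₂ : ∀ᶠ s in l₂, s ∈ I) {ℓ : ℝ} (hℓ : Tendsto F l₁ (𝓝 ℓ)) (htop : Tendsto F l₂ atTop)
    (hlt : ∀ s ∈ I, ℓ < F s) : F '' I = Ioi ℓ := by
  refine Subset.antisymm (image_subset_iff.2 fun s hs => hlt s hs) fun y hy => ?_
  obtain ⟨s, hs, hsy⟩ := (h₁.and (hℓ.eventually_lt_const (mem_Ioi.1 hy))).exists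
  obtain ⟨t, ht, hty⟩ := (h₂.and (htop.eventually_gt_atTop y)).exists
  exact (hI.image F hF).Icc_subset (mem_image_of_mem F hs) (mem_image_of_mem F ht)
    ⟨hsy.le, hty.le⟩

theorem image_eq_univ_of_tendsto {I : Set ℝ} (hI : IsPreconnected I) {F : ℝ → ℝ}
    (hF : ContinuousOn F I) {l₁ l₂ : Filter ℝ} [l₁.NeBot] [l₂.NeBot] (h₁ : ∀ᶠ s in l₁, s ∈ I)
    (h₂ : ∀ᶠ s in l₂, s ∈ I) (hbot : Tendsto F l₁ atBot) (htop : Tendsto F l₂ atTop) :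
    F '' I = univ := by
  refine eq_univ_of_forall fun y => ?_
  obtain ⟨s, hs, hsy⟩ := (h₁.and (hbot.eventually_lt_atBot y)).exists
  obtain ⟨t, ht, hty⟩ := (h₂.and (htop.eventually_gt_atTop y)).exists
  exact (hI.image F hF).Icc_subset (mem_image_of_mem F hs) (mem_image_of_mem F ht)
    ⟨hsy.le, hty.le⟩

/-- A strictly monotone function lies above its limit at the left end. -/
theorem lt_of_strictMonoOn_of_tendsto {I : Set ℝ} {F : ℝ → ℝ} (hF : StrictMonoOn F I)
    {l : Filter ℝ} [l.NeBot] {ℓ : ℝ} (hℓ : Tendsto F l (𝓝 ℓ))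
    (hl : ∀ s ∈ I, ∃ t ∈ I, t < s ∧ ∀ᶠ r in l, r ∈ I ∧ r ≤ t) {s : ℝ} (hs : s ∈ I) :
    ℓ < F s := by
  obtain ⟨t, ht, hts, h⟩ := hl s hs
  refine lt_of_le_of_lt ?_ (hF ht hs hts)
  exact le_of_tendsto hℓ (h.mono fun r hr => hF.monotoneOn hr.1 ht hr.2)

/-- A function with bounded derivative on a convex set has limits at the boundary. -/
theorem exists_tendsto_re_of_hasDerivAt_bounded {A : Set ℂ} (hA : Convex ℝ A) {b : ℂ}
    {Φ Φ' : ℂ → ℂ} (hΦ : ∀ P ∈ A, HasDerivAt Φ (Φ' P) P) {C : ℝ}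
    (hC : ∀ᶠ P in 𝓝[A] b, ‖Φ' P‖ ≤ C) :
    ∃ ℓ : ℝ, Tendsto (fun P => (Φ P).re) (𝓝[A] b) (𝓝 ℓ) := by
  obtain ⟨ε, hε, hball⟩ := Metric.mem_nhdsWithin_iff.1 hC
  have hconv : Convex ℝ (Metric.ball b ε ∩ A) := (convex_ball b ε).inter hA
  have hlip : LipschitzOnWith (Real.toNNReal C) Φ (Metric.ball b ε ∩ A) := by
    refine hconv.lipschitzOnWith_of_nnnorm_hasDerivWithin_le
      (fun P hP => (hΦ P hP.2).hasDerivWithinAt) (fun P hP => ?_)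
    rw [← NNReal.coe_le_coe, coe_nnnorm]
    exact (hball hP).trans (Real.le_coe_toNNReal C)
  have hlip' : LipschitzOnWith (Real.toNNReal C) (fun P => (Φ P).re) (Metric.ball b ε ∩ A) := by
    refine LipschitzOnWith.of_dist_le_mul fun x hx y hy => ?_
    refine le_trans ?_ (hlip.dist_le_mul x hx y hy)
    rw [Real.dist_eq, dist_eq_norm, ← Complex.sub_re]
    exact Complex.abs_re_le_norm _
  -- A real Lipschitz function extends to the whole plane, so the limit is simply the value of the
  -- extension at `b`.
  obtain ⟨G, hG, heq⟩ := hlip'.extend_real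
  refine ⟨G b, ((hG.continuous.tendsto b).mono_left nhdsWithin_le_nhds).congr' ?_⟩
  filter_upwards [self_mem_nhdsWithin, mem_nhdsWithin_of_mem_nhds (Metric.ball_mem_nhds b hε)]
    with P hP hP'
  exact (heq ⟨hP', hP⟩).symm

/-! ### The Cayley transform between disk and half-plane. -/

/-- The open right half-plane. -/
def rightHalf : Set ℂ := {P | 0 < P.re}

/-- The Cayley transform of the disk onto the right half-plane. -/
def cayley (z : ℂ) : ℂ := (1 + z) / (1 - z)

/-- The Cayley transform of the right half-plane onto the disk. -/
def cayleyInv (P : ℂ) : ℂ := (P - 1) / (P + 1)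

theorem isOpen_rightHalf : IsOpen rightHalf := isOpen_lt continuous_const Complex.continuous_re

theorem convex_rightHalf : Convex ℝ rightHalf := convex_halfSpace_re_gt 0

theorem mem_disk {z : ℂ} : z ∈ disk ↔ ‖z‖ < 1 := by simp [disk]

theorem isOpen_disk : IsOpen disk := Metric.isOpen_ball

theorem rightHalf_subset_slitPlane : rightHalf ⊆ Complex.slitPlane := fun _ h => Or.inl h

theorem ne_zero_of_mem_rightHalf {P : ℂ} (h : P ∈ rightHalf) : P ≠ 0 :=
  Complex.slitPlane_ne_zero (rightHalf_subset_slitPlane h)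

theorem add_one_ne_zero_of_re_nonneg {P : ℂ} (h : 0 ≤ P.re) : P + 1 ≠ 0 := by
  intro h0
  have := congrArg Complex.re h0
  simp at this
  linarith

theorem one_sub_ne_zero_of_mem_disk {z : ℂ} (h : z ∈ disk) : 1 - z ≠ 0 := by
  intro h0
  rw [sub_eq_zero] at h0
  rw [mem_disk, ← h0] at h
  simp at h

theorem one_add_ne_zero_of_mem_disk {z : ℂ} (h : z ∈ disk) : 1 + z ≠ 0 := by
  have : -z ∈ disk := by simpa [mem_disk] using h
  simpa using one_sub_ne_zero_of_mem_disk this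

theorem pow_mem_disk {n : ℕ} (hn : 1 ≤ n) {z : ℂ} (h : z ∈ disk) : z ^ n ∈ disk := by
  rw [mem_disk] at *
  rw [norm_pow]
  exact pow_lt_one₀ (norm_nonneg z) h (by omega)

theorem re_cayley (z : ℂ) : (cayley z).re = (1 - ‖z‖ ^ 2) / ‖1 - z‖ ^ 2 := by
  rw [cayley, Complex.div_re, ← Complex.normSq_eq_norm_sq, ← Complex.normSq_eq_norm_sq,
    ← add_div]
  congr 1
  simp [Complex.normSq_apply]
  ring

theorem cayley_mem_rightHalf {z : ℂ} (h : z ∈ disk) : cayley z ∈ rightHalf := by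
  change 0 < (cayley z).re
  rw [re_cayley]
  have h1 : 0 < ‖1 - z‖ := norm_pos_iff.2 (one_sub_ne_zero_of_mem_disk h)
  rw [mem_disk] at h
  have := norm_nonneg z
  apply div_pos _ (by positivity)
  nlinarith

theorem cayleyInv_mem_disk {P : ℂ} (h : P ∈ rightHalf) : cayleyInv P ∈ disk := by
  have h' : 0 < P.re := h
  have h1 : P + 1 ≠ 0 := add_one_ne_zero_of_re_nonneg h'.le
  rw [mem_disk, cayleyInv, norm_div, div_lt_one (norm_pos_iff.2 h1)]
  rw [← sq_lt_sq₀ (norm_nonneg _) (norm_nonneg _), ← Complex.normSq_eq_norm_sq,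
    ← Complex.normSq_eq_norm_sq]
  simp [Complex.normSq_apply]
  nlinarith

theorem cayley_cayleyInv {P : ℂ} (h : P + 1 ≠ 0) : cayley (cayleyInv P) = P := by
  rw [cayley, cayleyInv]
  have : 1 - (P - 1) / (P + 1) = 2 / (P + 1) := by field_simp; ring
  rw [this]
  field_simp
  ring

theorem cayleyInv_cayley {z : ℂ} (h : z ∈ disk) : cayleyInv (cayley z) = z := by
  have := one_sub_ne_zero_of_mem_disk h
  rw [cayley, cayleyInv]
  have h2 : (1 + z) / (1 - z) + 1 = 2 / (1 - z) := by field_simp; ring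
  rw [h2]
  field_simp
  ring

theorem cayley_image_disk : cayley '' disk = rightHalf :=
  Subset.antisymm (image_subset_iff.2 fun _ h => cayley_mem_rightHalf h)
    fun P h => ⟨cayleyInv P, cayleyInv_mem_disk h, cayley_cayleyInv
      (add_one_ne_zero_of_re_nonneg (le_of_lt h))⟩

theorem hasDerivAt_cayley {z : ℂ} (h : 1 - z ≠ 0) : HasDerivAt cayley (2 / (1 - z) ^ 2) z := by
  have := ((hasDerivAt_id z).const_add 1).div ((hasDerivAt_id z).const_sub 1) h
  refine this.congr_deriv ?_
  simp only [id]
  congr 1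
  ring

theorem hasDerivAt_cayleyInv {P : ℂ} (h : P + 1 ≠ 0) :
    HasDerivAt cayleyInv (2 / (P + 1) ^ 2) P := by
  have := ((hasDerivAt_id P).sub_const 1).div ((hasDerivAt_id P).add_const 1) h
  refine this.congr_deriv ?_
  simp only [id]
  congr 1
  ring

/-! ### The Herglotz kernel: lower bounds by single poles, and asymptotics at ∞ and 0. -/

/-- The function `(1 + zⁿ) / (1 - zⁿ)` in the half-plane coordinate. -/
def herglotz (n : ℕ) (P : ℂ) : ℂ := cayley (cayleyInv P ^ n)

/-- A Cauchy-Schwarz estimate for the Herglotz kernel. -/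
theorem re_cayley_le_re_cayley_pow {n : ℕ} (hn : 1 ≤ n) {x : ℂ} (hx : x ∈ disk) :
    (cayley x).re / n ≤ (cayley (x ^ n)).re := by
  have hn' : (0 : ℝ) < n := by exact_mod_cast hn
  have hx1 : 0 < ‖1 - x‖ := norm_pos_iff.2 (one_sub_ne_zero_of_mem_disk hx)
  have hxn : 0 < ‖1 - x ^ n‖ := norm_pos_iff.2 (one_sub_ne_zero_of_mem_disk (pow_mem_disk hn hx))
  rw [mem_disk] at hx
  have hr : 0 ≤ 1 - ‖x‖ ^ 2 := by nlinarith [norm_nonneg x]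
  rw [re_cayley, re_cayley]
  -- Both 1 - x^n and 1 - ‖x‖^(2n) are factored as geometric sums. After `re_cayley`, what remains
  -- is Cauchy-Schwarz for the numbers ‖x‖^j against n ones.
  have hS : ‖1 - x ^ n‖ ≤ (∑ j ∈ Finset.range n, ‖x‖ ^ j) * ‖1 - x‖ := by
    rw [← geom_sum_mul_neg, norm_mul]
    gcongr
    exact (norm_sum_le _ _).trans (Finset.sum_le_sum fun j _ => (norm_pow x j).le)
  have hT : 1 - ‖x ^ n‖ ^ 2 = (∑ j ∈ Finset.range n, (‖x‖ ^ j) ^ 2) * (1 - ‖x‖ ^ 2) := by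
    have := geom_sum_mul_neg (‖x‖ ^ 2) n
    rw [norm_pow, ← pow_mul, mul_comm n 2, pow_mul, ← this]
    congr 1
    exact Finset.sum_congr rfl fun j _ => by rw [← pow_mul, ← pow_mul, mul_comm]
  have hCS : (∑ j ∈ Finset.range n, ‖x‖ ^ j) ^ 2 ≤ n * ∑ j ∈ Finset.range n, (‖x‖ ^ j) ^ 2 := by
    simpa using sq_sum_le_card_mul_sum_sq (s := Finset.range n) (f := fun j => ‖x‖ ^ j)
  rw [hT, div_div, div_le_div_iff₀ (by positivity) (by positivity)]
  have h1 : ‖1 - x ^ n‖ ^ 2 ≤ (n * ∑ j ∈ Finset.range n, (‖x‖ ^ j) ^ 2) * ‖1 - x‖ ^ 2 := by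
    calc ‖1 - x ^ n‖ ^ 2 ≤ ((∑ j ∈ Finset.range n, ‖x‖ ^ j) * ‖1 - x‖) ^ 2 := by gcongr
      _ = (∑ j ∈ Finset.range n, ‖x‖ ^ j) ^ 2 * ‖1 - x‖ ^ 2 := by ring
      _ ≤ _ := by gcongr
  calc (1 - ‖x‖ ^ 2) * ‖1 - x ^ n‖ ^ 2
      ≤ (1 - ‖x‖ ^ 2) * ((n * ∑ j ∈ Finset.range n, (‖x‖ ^ j) ^ 2) * ‖1 - x‖ ^ 2) := by gcongr
    _ = _ := by ring

theorem re_herglotz_pos {n : ℕ} (hn : 1 ≤ n) {P : ℂ} (hP : P ∈ rightHalf) :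
    0 < (herglotz n P).re :=
  cayley_mem_rightHalf (pow_mem_disk hn (cayleyInv_mem_disk hP))

/-- The contribution of the pole z = 1, that is P = ∞. It governs the right ends of the slices, and
also the left ends when c = 2. -/
theorem re_div_le_re_herglotz {n : ℕ} (hn : 1 ≤ n) {P : ℂ} (hP : P ∈ rightHalf) :
    P.re / n ≤ (herglotz n P).re := by
  have h := re_cayley_le_re_cayley_pow hn (cayleyInv_mem_disk hP)
  rwa [cayley_cayleyInv (add_one_ne_zero_of_re_nonneg (le_of_lt hP))] at h

/-- Lower bound of the Herglotz kernel by one of its boundary poles. -/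
theorem re_inv_sub_le_re_herglotz {n : ℕ} (hn : 1 ≤ n) {P b : ℂ} (hP : P ∈ rightHalf)
    (hb : b.re = 0) (hbn : cayleyInv b ^ n = 1) :
    ((P - b)⁻¹).re / n ≤ (herglotz n P).re := by
  have hb1 : b + 1 ≠ 0 := add_one_ne_zero_of_re_nonneg hb.ge
  have hP1 : P + 1 ≠ 0 := add_one_ne_zero_of_re_nonneg (le_of_lt hP)
  have hP0 : 0 < P.re := hP
  have hPb : P - b ≠ 0 := by
    intro h
    have := congrArg Complex.re h
    simp at this
    linarith
  -- Dividing by the root of unity `cayleyInv b` rotates the pole to z = 1 and leaves the n-th power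
  -- unchanged.
  set x := cayleyInv P / cayleyInv b with hx
  have hn1 : ‖cayleyInv b‖ = 1 := Complex.norm_eq_one_of_pow_eq_one hbn (by omega)
  have hb0 : cayleyInv b ≠ 0 := by
    rw [← norm_pos_iff, hn1]; norm_num
  have hbm : b - 1 ≠ 0 := by
    intro h
    apply hb0
    simp [cayleyInv, h]
  have hxd : x ∈ disk := by
    rw [mem_disk, hx, norm_div, hn1, div_one, ← mem_disk]
    exact cayleyInv_mem_disk hP
  have hxn : x ^ n = cayleyInv P ^ n := by rw [hx, div_pow, hbn, div_one]
  have h := re_cayley_le_re_cayley_pow hn hxd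
  rw [hxn] at h
  refine le_trans ?_ h
  -- As a Möbius function of P this has its pole at `b`. Since `b` is imaginary, the coefficient 1 -
  -- b² = 1 + (Im b)² is at least 1 and the constant term has no real part.
  have hform : cayley x = -b + (1 - b ^ 2) * (P - b)⁻¹ := by
    have h1 : 1 - x = -2 * (P - b) / ((P + 1) * (b - 1)) := by
      rw [hx, cayleyInv, cayleyInv]; field_simp; ring
    have h2 : 1 + x = (2 * P * b - 2) / ((P + 1) * (b - 1)) := by
      rw [hx, cayleyInv, cayleyInv]; field_simp; ring
    rw [cayley, h1, h2]
    field_simp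
    ring
  have hb2 : (1 - b ^ 2 : ℂ) = ((1 + b.im ^ 2 : ℝ) : ℂ) := by
    apply Complex.ext <;> simp [pow_two, hb]
  have hpos : 0 ≤ ((P - b)⁻¹).re := by
    rw [Complex.inv_re]
    apply div_nonneg _ (Complex.normSq_nonneg _)
    simp [hb, hP0.le]
  refine div_le_div_of_nonneg_right ?_ (Nat.cast_nonneg n)
  rw [hform, hb2, Complex.add_re, Complex.re_ofReal_mul]
  simp only [Complex.neg_re, hb]
  nlinarith [sq_nonneg b.im]

/-- P = 0 corresponds to z = -1, an n-th root of unity because n is even. -/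
theorem re_inv_le_re_herglotz {n : ℕ} (hn : 1 ≤ n) (he : Even n) {P : ℂ} (hP : P ∈ rightHalf) :
    (P⁻¹).re / n ≤ (herglotz n P).re := by
  have := re_inv_sub_le_re_herglotz hn (b := 0) hP rfl (by simp [cayleyInv, he.neg_one_pow])
  simpa using this

theorem continuousAt_herglotz {n : ℕ} {P : ℂ} (hP : P + 1 ≠ 0) (hn : 1 - cayleyInv P ^ n ≠ 0) :
    ContinuousAt (herglotz n) P :=
  (hasDerivAt_cayley hn).continuousAt.comp (f := fun P => cayleyInv P ^ n)
    ((hasDerivAt_cayleyInv hP).continuousAt.pow n)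

/-- At infinity the Herglotz kernel behaves like `P / n`. -/
theorem tendsto_herglotz_div {n : ℕ} (hn : 1 ≤ n) :
    Tendsto (fun P => herglotz n P / P) (Bornology.cobounded ℂ) (𝓝 (1 / n)) := by
  have hn' : (n : ℂ) ≠ 0 := by exact_mod_cast (by omega : n ≠ 0)
  have hev : ∀ᶠ P : ℂ in Bornology.cobounded ℂ, P + 1 ≠ 0 := by
    filter_upwards [tendsto_norm_cobounded_atTop.eventually_gt_atTop (1 : ℝ)] with P hP h
    rw [eq_neg_of_add_eq_zero_left h] at hP
    simp at hP
  have hlim : Tendsto cayleyInv (Bornology.cobounded ℂ) (𝓝 1) := by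
    have h1 : Tendsto (fun P : ℂ => 1 - 2 * (P + 1)⁻¹) (Bornology.cobounded ℂ) (𝓝 (1 - 2 * 0)) :=
      ((Filter.tendsto_inv₀_cobounded.comp
        (tendsto_add_const_cobounded (1 : ℂ))).const_mul 2).const_sub 1
    simp only [mul_zero, sub_zero] at h1
    refine h1.congr' ?_
    filter_upwards [hev] with P hP
    rw [cayleyInv]
    field_simp
    ring
  -- The quotient kernel / P with the common factor 1 - z cancelled, hence continuous at z = 1.
  have hcont : ContinuousAt
      (fun z : ℂ => (1 + z ^ n) / ((∑ j ∈ Finset.range n, z ^ j) * (1 + z))) 1 := by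
    refine ContinuousAt.div (by fun_prop) (by fun_prop) ?_
    norm_num [hn']
  have h2 := hcont.tendsto.comp hlim
  have h3 : ((1 + 1 ^ n) / ((∑ j ∈ Finset.range n, 1 ^ j) * (1 + 1)) : ℂ) = 1 / n := by
    simp
    field_simp
  rw [h3] at h2
  refine h2.congr' ?_
  filter_upwards [hev] with P hP1
  have hz : 1 - cayleyInv P ≠ 0 := by
    have : 1 - cayleyInv P = 2 / (P + 1) := by rw [cayleyInv]; field_simp; ring
    rw [this]
    exact div_ne_zero two_ne_zero hP1
  simp only [Function.comp]
  have hPc : P = cayley (cayleyInv P) := (cayley_cayleyInv hP1).symm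
  rw [herglotz]
  conv_rhs => rw [hPc]
  have hzz : cayleyInv (cayley (cayleyInv P)) = cayleyInv P := by rw [← hPc]
  rw [hzz, cayley, cayley, ← geom_sum_mul_neg]
  -- Where a denominator vanishes, both sides are 0 by the convention x / 0 = 0.
  by_cases hs : (∑ j ∈ Finset.range n, cayleyInv P ^ j) = 0
  · simp [hs]
  by_cases hs' : 1 + cayleyInv P = 0
  · simp [hs']
  field_simp

/-- For odd n the point z = -1 is a zero of 1 + z^n, so the kernel vanishes at P = 0 instead of
having a pole. -/
theorem herglotz_isBigO_of_odd {n : ℕ} (ho : Odd n) :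
    ∃ C : ℝ, ∀ᶠ P in 𝓝[rightHalf] 0, ‖herglotz n P‖ ≤ C * ‖P‖ := by
  have h0 : cayleyInv 0 ^ n = -1 := by simp [cayleyInv, ho.neg_one_pow]
  have hd : HasDerivAt (herglotz n) _ 0 :=
    HasDerivAt.comp (h₂ := cayley) (h := fun P => cayleyInv P ^ n) 0
      (hasDerivAt_cayley (by rw [h0]; norm_num))
      ((hasDerivAt_cayleyInv (P := 0) (by norm_num)).pow n)
  have hz : herglotz n 0 = 0 := by rw [herglotz, h0]; simp [cayley]
  obtain ⟨C, hC⟩ := hd.isBigO_sub.bound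
  refine ⟨C, (hC.filter_mono nhdsWithin_le_nhds).mono fun P hP => ?_⟩
  simpa [hz] using hP

/-- The singularity at P = 0 is at most a simple pole. Splitting it off lets the shear be integrated
explicitly near 0. -/
theorem herglotz_sub_div_bounded {n : ℕ} (hn : 1 ≤ n) :
    ∃ (a : ℂ) (C : ℝ), ∀ᶠ P in 𝓝[rightHalf] 0, ‖herglotz n P - a / P‖ ≤ C := by
  rcases Nat.even_or_odd n with he | ho
  · obtain ⟨m, rfl⟩ := he
    have hm : (m : ℂ) ≠ 0 := by exact_mod_cast (by omega : m ≠ 0)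
    -- This is P times the kernel after cancelling 1 + z, using 1 - z^(2m) = (1 - z)(1 + z) Σ
    -- z^(2j). It is regular at P = 0, and `A 0` is the coefficient of the pole.
    set A : ℂ → ℂ := fun P => (1 + cayleyInv P ^ (m + m)) /
      ((∑ j ∈ Finset.range m, (cayleyInv P ^ 2) ^ j) * (1 - cayleyInv P) ^ 2) with hA
    have h0 : cayleyInv 0 = -1 := by simp [cayleyInv]
    have hc : DifferentiableAt ℂ cayleyInv 0 :=
      (hasDerivAt_cayleyInv (P := 0) (by norm_num)).differentiableAt
    have hdA : DifferentiableAt ℂ A 0 := by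
      refine DifferentiableAt.div (by fun_prop) (by fun_prop) ?_
      rw [h0]
      norm_num [hm]
    obtain ⟨C, hC⟩ := hdA.hasDerivAt.isBigO_sub.bound
    refine ⟨A 0, C, ?_⟩
    filter_upwards [hC.filter_mono nhdsWithin_le_nhds, self_mem_nhdsWithin] with P hP hPH
    have hP0 : P ≠ 0 := ne_zero_of_mem_rightHalf hPH
    have hz := cayleyInv_mem_disk hPH
    have hAP : herglotz (m + m) P * P = A P := by
      have h1 := one_sub_ne_zero_of_mem_disk hz
      have h2 := one_add_ne_zero_of_mem_disk hz
      have h3 := one_sub_ne_zero_of_mem_disk (pow_mem_disk hn hz)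
      have h4 := geom_sum_mul_neg (cayleyInv P ^ 2) m
      rw [← pow_mul, two_mul] at h4
      have hPc := cayley_cayleyInv (add_one_ne_zero_of_re_nonneg (le_of_lt hPH))
      simp only [hA]
      rw [herglotz]
      conv_lhs => rw [← hPc]
      rw [cayleyInv_cayley hz]
      generalize cayleyInv P = z at *
      have h5 : ∑ j ∈ Finset.range m, (z ^ 2) ^ j ≠ 0 := by
        intro h
        rw [h, zero_mul] at h4
        exact h3 h4.symm
      rw [cayley, cayley, ← h4, show (1 - z ^ 2) = (1 - z) * (1 + z) by ring]
      field_simp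
    have : herglotz (m + m) P - A 0 / P = (A P - A 0) / P := by
      rw [← hAP]
      field_simp
    rw [this, norm_div, div_le_iff₀ (norm_pos_iff.2 hP0)]
    simpa using hP
  · obtain ⟨C, hC⟩ := herglotz_isBigO_of_odd ho
    refine ⟨0, |C|, ?_⟩
    have h1 : ∀ᶠ P : ℂ in 𝓝[rightHalf] 0, ‖P‖ < 1 :=
      nhdsWithin_le_nhds ((continuous_norm.tendsto (0 : ℂ)).eventually_lt_const (by simp))
    filter_upwards [hC, h1] with P hP hP1
    rw [zero_div, sub_zero]
    calc ‖herglotz n P‖ ≤ C * ‖P‖ := hP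
      _ ≤ |C| * 1 := mul_le_mul (le_abs_self C) hP1.le (norm_nonneg _) (abs_nonneg C)
      _ = |C| := mul_one _

/-! ### The generalized Koebe function on the half-plane: inverse and range. -/

/-- The generalized Koebe function in the half-plane coordinate. -/
def powK (c : ℝ) (P : ℂ) : ℂ :=
  if c = 0 then (1 / 2) * Complex.log P else (1 / (2 * (c : ℂ))) * (P ^ (c : ℂ) - 1)

/-- The inverse of `powK c`. -/
def powJ (c : ℝ) (w : ℂ) : ℂ :=
  if c = 0 then Complex.exp (2 * w) else (1 + 2 * c * w) ^ (1 / (c : ℂ))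

theorem koebe_eq_powK (c : ℝ) (z : ℂ) : koebe c z = powK c (cayley z) := rfl

theorem hasStrictDerivAt_powK (c : ℝ) {P : ℂ} (hP : P ∈ Complex.slitPlane) :
    HasStrictDerivAt (powK c) (P ^ ((c : ℂ) - 1) / 2) P := by
  have hP0 := Complex.slitPlane_ne_zero hP
  by_cases hc : c = 0
  · have : powK c = fun P => (1 / 2) * Complex.log P := by funext P; simp [powK, hc]
    rw [this]
    refine ((Complex.hasStrictDerivAt_log hP).const_mul (1 / 2)).congr_deriv ?_
    rw [hc, Complex.ofReal_zero, zero_sub, Complex.cpow_neg_one]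
    ring
  · have : powK c = fun P => (1 / (2 * (c : ℂ))) * (P ^ (c : ℂ) - 1) := by
      funext P; simp [powK, hc]
    rw [this]
    have hc' : (c : ℂ) ≠ 0 := by exact_mod_cast hc
    have h : HasStrictDerivAt (fun P : ℂ => P ^ (c : ℂ) - 1) (c * P ^ ((c : ℂ) - 1)) P := by
      have h0 := (hasStrictDerivAt_id P).cpow (hasStrictDerivAt_const P (c : ℂ)) hP
      simp only [id, mul_one, mul_zero, add_zero] at h0
      exact h0.sub_const 1
    refine (h.const_mul (1 / (2 * (c : ℂ)))).congr_deriv ?_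
    field_simp

theorem hasDerivAt_powK (c : ℝ) {P : ℂ} (hP : P ∈ rightHalf) :
    HasDerivAt (powK c) (P ^ ((c : ℂ) - 1) / 2) P :=
  (hasStrictDerivAt_powK c (rightHalf_subset_slitPlane hP)).hasDerivAt

theorem log_im_of_mem_rightHalf {P : ℂ} (hP : P ∈ rightHalf) : |(Complex.log P).im| < π / 2 := by
  rw [Complex.log_im]
  exact Complex.abs_arg_lt_pi_div_two_iff.2 (Or.inl hP)

theorem exp_mem_rightHalf {ζ : ℂ} (h : |ζ.im| < π / 2) : Complex.exp ζ ∈ rightHalf := by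
  change 0 < (Complex.exp ζ).re
  rw [Complex.exp_re]
  obtain ⟨h1, h2⟩ := abs_lt.1 h
  have := Real.cos_pos_of_mem_Ioo ⟨by linarith, h2⟩
  positivity

/-- Arguments in the right half-plane are below π/2 in absolute value, so multiplying them by c ≤ 2
stays within the principal branch. This is what makes `powK c` injective. -/
theorem log_cpow_of_mem_rightHalf {c : ℝ} (hc0 : 0 < c) (hc2 : c ≤ 2) {P : ℂ}
    (hP : P ∈ rightHalf) : Complex.log (P ^ (c : ℂ)) = Complex.log P * c := by
  have h := abs_lt.1 (log_im_of_mem_rightHalf hP)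
  have hpi := Real.pi_pos
  rw [Complex.cpow_def_of_ne_zero (ne_zero_of_mem_rightHalf hP), Complex.log_exp]
  · rw [Complex.im_mul_ofReal]; nlinarith
  · rw [Complex.im_mul_ofReal]; nlinarith

theorem powJ_powK {c : ℝ} (hc : c ∈ Icc (0 : ℝ) 2) {P : ℂ} (hP : P ∈ rightHalf) :
    powJ c (powK c P) = P := by
  have hP0 := ne_zero_of_mem_rightHalf hP
  by_cases hc0 : c = 0
  · simp only [powJ, powK, hc0, if_true]
    rw [← mul_assoc]
    norm_num [Complex.exp_log hP0]
  · have hc0' : 0 < c := lt_of_le_of_ne hc.1 (Ne.symm hc0)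
    have hc' : (c : ℂ) ≠ 0 := by exact_mod_cast hc0
    simp only [powJ, powK, hc0, if_false]
    have : 1 + 2 * (c : ℂ) * (1 / (2 * (c : ℂ)) * (P ^ (c : ℂ) - 1)) = P ^ (c : ℂ) := by
      field_simp; ring
    rw [this, Complex.cpow_def_of_ne_zero (by simp [hP0]),
      log_cpow_of_mem_rightHalf hc0' hc.2 hP]
    have : Complex.log P * c * (1 / c) = Complex.log P := by field_simp
    rw [this, Complex.exp_log hP0]

/-- The range of `powK c` on the right half-plane. -/
def powRange (c : ℝ) : Set ℂ := powK c '' rightHalf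

theorem deriv_powK_ne_zero (c : ℝ) {P : ℂ} (hP : P ∈ rightHalf) :
    P ^ ((c : ℂ) - 1) / 2 ≠ 0 := by
  have hP0 := ne_zero_of_mem_rightHalf hP
  simp [Complex.cpow_eq_zero_iff, hP0]

theorem powJ_mem {c : ℝ} (hc : c ∈ Icc (0 : ℝ) 2) {w : ℂ} (hw : w ∈ powRange c) :
    powJ c w ∈ rightHalf := by
  obtain ⟨P, hP, rfl⟩ := hw
  rwa [powJ_powK hc hP]

theorem powK_powJ {c : ℝ} (hc : c ∈ Icc (0 : ℝ) 2) {w : ℂ} (hw : w ∈ powRange c) :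
    powK c (powJ c w) = w := by
  obtain ⟨P, hP, rfl⟩ := hw
  rw [powJ_powK hc hP]

theorem isOpen_powRange (c : ℝ) : IsOpen (powRange c) := by
  rw [isOpen_iff_mem_nhds]
  rintro _ ⟨P, hP, rfl⟩
  rw [← (hasStrictDerivAt_powK c (rightHalf_subset_slitPlane hP)).map_nhds_eq
    (deriv_powK_ne_zero c hP)]
  exact image_mem_map (isOpen_rightHalf.mem_nhds hP)

theorem hasDerivAt_powJ {c : ℝ} (hc : c ∈ Icc (0 : ℝ) 2) {w : ℂ} (hw : w ∈ powRange c) :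
    HasDerivAt (powJ c) ((powJ c w) ^ ((c : ℂ) - 1) / 2)⁻¹ w := by
  obtain ⟨P, hP, rfl⟩ := hw
  rw [powJ_powK hc hP]
  refine ((hasStrictDerivAt_powK c (rightHalf_subset_slitPlane hP)).to_local_left_inverse
    (deriv_powK_ne_zero c hP) ?_).hasDerivAt
  filter_upwards [isOpen_rightHalf.mem_nhds hP] with Q hQ
  exact powJ_powK hc hQ

theorem mem_powRange_of {c : ℝ} {w : ℂ} (h : powJ c w ∈ rightHalf)
    (h' : powK c (powJ c w) = w) : w ∈ powRange c := ⟨_, h, h'⟩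

theorem mem_powRange_zero {w : ℂ} : w ∈ powRange 0 ↔ |w.im| < π / 4 := by
  constructor
  · rintro ⟨P, hP, rfl⟩
    have h := log_im_of_mem_rightHalf hP
    have : (powK 0 P).im = (Complex.log P).im / 2 := by
      simp only [powK, if_true]
      rw [show (1 / 2 : ℂ) = ((1 / 2 : ℝ) : ℂ) by norm_num, Complex.im_ofReal_mul]
      ring
    rw [this, abs_div, abs_two]
    linarith
  · intro h
    have h2 : (2 * w).im = 2 * w.im := by simp
    have h3 := abs_lt.1 h
    have hpi := Real.pi_pos
    refine mem_powRange_of ?_ ?_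
    · simp only [powJ, if_true]
      refine exp_mem_rightHalf ?_
      rw [h2, abs_mul, abs_two]
      linarith
    · simp only [powJ, powK, if_true]
      rw [Complex.log_exp (by rw [h2]; linarith) (by rw [h2]; linarith)]
      ring

theorem mem_powRange_iff_arg {c : ℝ} (hc0 : 0 < c) (hc2 : c ≤ 2) {w : ℂ} :
    w ∈ powRange c ↔ 1 + 2 * c * w ≠ 0 ∧ |Complex.arg (1 + 2 * c * w)| < c * π / 2 := by
  have hc' : (c : ℂ) ≠ 0 := by exact_mod_cast hc0.ne'
  have hpi := Real.pi_pos
  constructor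
  · rintro ⟨P, hP, rfl⟩
    have hP0 := ne_zero_of_mem_rightHalf hP
    have h1 : 1 + 2 * (c : ℂ) * powK c P = P ^ (c : ℂ) := by
      simp only [powK, hc0.ne', if_false]; field_simp; ring
    rw [h1]
    refine ⟨by simp [hP0], ?_⟩
    rw [← Complex.log_im, log_cpow_of_mem_rightHalf hc0 hc2 hP, Complex.im_mul_ofReal, abs_mul,
      abs_of_pos hc0]
    nlinarith [log_im_of_mem_rightHalf hP]
  · rintro ⟨h0, h1⟩
    set W := 1 + 2 * c * w with hW
    have him : (Complex.log W * (1 / (c : ℂ))).im = Complex.arg W / c := by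
      rw [show (1 / (c : ℂ)) = ((1 / c : ℝ) : ℂ) by push_cast; rfl, Complex.im_mul_ofReal,
        Complex.log_im]
      ring
    have hlt : |(Complex.log W * (1 / (c : ℂ))).im| < π / 2 := by
      rw [him, abs_div, abs_of_pos hc0, div_lt_iff₀ hc0]
      linarith
    have hJ : powJ c w = Complex.exp (Complex.log W * (1 / (c : ℂ))) := by
      simp only [powJ, hc0.ne', if_false, ← hW]
      rw [Complex.cpow_def_of_ne_zero h0]
    have hlt' := abs_lt.1 hlt
    refine mem_powRange_of ?_ ?_
    · rw [hJ]; exact exp_mem_rightHalf hlt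
    · rw [hJ]
      simp only [powK, hc0.ne', if_false]
      rw [Complex.cpow_def_of_ne_zero (Complex.exp_ne_zero _),
        Complex.log_exp (by linarith) (by linarith)]
      have : Complex.log W * (1 / (c : ℂ)) * c = Complex.log W := by field_simp
      rw [this, Complex.exp_log h0, hW]
      field_simp
      ring

theorem mem_powRange_two {w : ℂ} : w ∈ powRange 2 ↔ w.im ≠ 0 ∨ -(1 / 4) < w.re := by
  rw [mem_powRange_iff_arg two_pos le_rfl]
  have h1 : (1 + 2 * ((2 : ℝ) : ℂ) * w).re = 1 + 4 * w.re := by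
    norm_num
  have h2 : (1 + 2 * ((2 : ℝ) : ℂ) * w).im = 4 * w.im := by
    norm_num
  have h3 : (2 : ℝ) * π / 2 = π := by ring
  rw [h3]
  set W := 1 + 2 * ((2 : ℝ) : ℂ) * w
  have : (W ≠ 0 ∧ |Complex.arg W| < π) ↔ W ∈ Complex.slitPlane := by
    rw [Complex.mem_slitPlane_iff_arg]
    constructor
    · rintro ⟨h, h'⟩
      exact ⟨(lt_of_abs_lt h').ne, h⟩
    · rintro ⟨h, h'⟩
      exact ⟨h', abs_lt.2 ⟨Complex.neg_pi_lt_arg W, lt_of_le_of_ne (Complex.arg_le_pi W) h⟩⟩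
  rw [this, Complex.mem_slitPlane_iff, h1, h2]
  constructor
  · rintro (h | h)
    · right; linarith
    · left; intro h'; exact h (by rw [h', mul_zero])
  · rintro (h | h)
    · right; simpa using h
    · left; linarith

/-- For W ≠ 0 both sides say sin(β - |arg W|) > 0. The right side is linear in Re W, so the left end
of each horizontal slice can be read off. -/
theorem sector_iff {β : ℝ} (h0 : 0 < β) (hπ : β < π) {W : ℂ} :
    W ≠ 0 ∧ |Complex.arg W| < β ↔ |W.im| * Real.cos β < W.re * Real.sin β := by
  have hpi := Real.pi_pos
  by_cases hW : W = 0
  · simp [hW]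
  have hn : 0 < ‖W‖ := norm_pos_iff.2 hW
  set α := Complex.arg W with hα
  have hre : W.re = ‖W‖ * Real.cos |α| := by
    rw [Real.cos_abs, hα, Complex.cos_arg hW]; field_simp
  have hle : |α| ≤ π := Complex.abs_arg_le_pi W
  have him : |W.im| = ‖W‖ * Real.sin |α| := by
    have : W.im = ‖W‖ * Real.sin α := by rw [hα, Complex.sin_arg]; field_simp
    rw [this, abs_mul, abs_of_pos hn]
    congr 1
    rcases le_total 0 α with h | h
    · rw [abs_of_nonneg h, abs_of_nonneg]
      rw [abs_of_nonneg h] at hle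
      exact Real.sin_nonneg_of_nonneg_of_le_pi h hle
    · rw [abs_of_nonpos h, Real.sin_neg, abs_of_nonpos]
      rw [abs_of_nonpos h] at hle
      have := Real.sin_nonneg_of_nonneg_of_le_pi (x := -α) (by linarith) hle
      rw [Real.sin_neg] at this
      linarith
  rw [him, hre]
  have key : ‖W‖ * Real.cos |α| * Real.sin β - ‖W‖ * Real.sin |α| * Real.cos β
      = ‖W‖ * Real.sin (β - |α|) := by rw [Real.sin_sub]; ring
  constructor
  · rintro ⟨-, h⟩
    have : 0 < Real.sin (β - |α|) :=
      Real.sin_pos_of_pos_of_lt_pi (by linarith) (by linarith [abs_nonneg α])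
    nlinarith [mul_pos hn this]
  · intro h
    refine ⟨hW, ?_⟩
    by_contra hcon
    push Not at hcon
    have : Real.sin (β - |α|) ≤ 0 :=
      Real.sin_nonpos_of_nonpos_of_neg_pi_le (by linarith) (by linarith)
    nlinarith [mul_nonneg hn.le (neg_nonneg.2 this)]

/-! ### Left ends of horizontal slices for 0 < c < 2 and their preimages on the imaginary axis. -/

/-- The left end of the horizontal slice of `powRange c` at height `v`. -/
def sliceEnd (c v : ℝ) : ℝ := |v| * (Real.cos (c * π / 2) / Real.sin (c * π / 2)) - 1 / (2 * c)

theorem angle_bounds {c : ℝ} (hc : c ∈ Ioo (0 : ℝ) 2) : 0 < c * π / 2 ∧ c * π / 2 < π := by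
  have := Real.pi_pos
  constructor <;> nlinarith [hc.1, hc.2]

theorem sin_angle_pos {c : ℝ} (hc : c ∈ Ioo (0 : ℝ) 2) : 0 < Real.sin (c * π / 2) :=
  Real.sin_pos_of_pos_of_lt_pi (angle_bounds hc).1 (angle_bounds hc).2

theorem mem_powRange_iff {c : ℝ} (hc : c ∈ Ioo (0 : ℝ) 2) {w : ℂ} :
    w ∈ powRange c ↔ sliceEnd c w.im < w.re := by
  have hs := sin_angle_pos hc
  have hc0 := hc.1
  rw [mem_powRange_iff_arg hc0 hc.2.le, sector_iff (angle_bounds hc).1 (angle_bounds hc).2]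
  have h1 : (1 + 2 * (c : ℂ) * w).re = 1 + 2 * c * w.re := by simp
  have h2 : (1 + 2 * (c : ℂ) * w).im = 2 * c * w.im := by simp
  rw [h1, h2, abs_mul, abs_of_pos (by positivity : 0 < 2 * c), sliceEnd]
  rw [← mul_lt_mul_iff_left₀ (b := _ - _) (a := 2 * c * Real.sin (c * π / 2)) (by positivity)]
  have : (|w.im| * (Real.cos (c * π / 2) / Real.sin (c * π / 2)) - 1 / (2 * c)) *
      (2 * c * Real.sin (c * π / 2)) =
      2 * c * |w.im| * Real.cos (c * π / 2) - Real.sin (c * π / 2) := by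
    field_simp
  rw [this]
  constructor <;> intro h <;> nlinarith

/-- The boundary point of `powRange c` at height `v`, pulled back to the imaginary axis. -/
def sliceBdry (c v : ℝ) : ℂ := powJ c ⟨sliceEnd c v, v⟩

/-- The left end lies on an edge of the sector, at argument ±cπ/2 with the sign of `v`; its height
2cv determines the modulus. Since cπ/2 < π, the logarithm is the principal one. -/
theorem one_add_sliceEnd {c : ℝ} (hc : c ∈ Ioo (0 : ℝ) 2) {v : ℝ} (hv : v ≠ 0) :
    ∃ σ : ℝ, |σ| = c * π / 2 ∧
      Complex.log (1 + 2 * c * ⟨sliceEnd c v, v⟩) =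
        ⟨Real.log (2 * c * |v| / Real.sin (c * π / 2)), σ⟩ ∧
      (1 + 2 * c * ⟨sliceEnd c v, v⟩ : ℂ) ≠ 0 ∧
      (1 + 2 * c * ⟨sliceEnd c v, v⟩ : ℂ) ∈ Complex.slitPlane := by
  have hs := sin_angle_pos hc
  have hc0 := hc.1
  have hb := angle_bounds hc
  have hv' := abs_pos.2 hv
  set β := c * π / 2 with hβ
  have hρ : 0 < 2 * c * |v| / Real.sin β := by positivity
  have him : (1 + 2 * c * ⟨sliceEnd c v, v⟩ : ℂ).im = 2 * c * v := by simp
  have key : ∀ σ : ℝ, |σ| = β → v * Real.sin β = |v| * Real.sin σ →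
      (1 + 2 * c * ⟨sliceEnd c v, v⟩ : ℂ) =
        Complex.exp ⟨Real.log (2 * c * |v| / Real.sin β), σ⟩ := by
    intro σ hσ hσ'
    apply Complex.ext
    · rw [Complex.exp_re]
      simp only [Complex.add_re, Complex.one_re, Complex.mul_re, Complex.re_ofNat,
        Complex.ofReal_re, Complex.im_ofNat, Complex.ofReal_im, Complex.mul_im]
      rw [Real.exp_log hρ, ← Real.cos_abs σ, hσ, sliceEnd, ← hβ]
      field_simp
      ring
    · rw [him, Complex.exp_im]
      simp only
      rw [Real.exp_log hρ]
      field_simp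
      rw [← hσ']
  have hne : (1 + 2 * c * ⟨sliceEnd c v, v⟩ : ℂ).im ≠ 0 := by
    rw [him]; positivity
  obtain ⟨σ, hσ, hσ'⟩ : ∃ σ : ℝ, |σ| = β ∧ v * Real.sin β = |v| * Real.sin σ := by
    rcases lt_or_gt_of_ne hv with h | h
    · exact ⟨-β, by rw [abs_neg, abs_of_pos hb.1], by rw [abs_of_neg h, Real.sin_neg]; ring⟩
    · exact ⟨β, abs_of_pos hb.1, by rw [abs_of_pos h]⟩
  refine ⟨σ, hσ, ?_, ?_, Complex.mem_slitPlane_iff.2 (Or.inr hne)⟩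
  · rw [key σ hσ hσ', Complex.log_exp]
    · simp only; have := neg_abs_le σ; linarith [hb.2]
    · simp only; have := le_abs_self σ; linarith [hb.2]
  · intro h
    rw [h] at hne
    simp at hne

theorem one_add_sliceEnd_zero {c : ℝ} (hc : c ∈ Ioo (0 : ℝ) 2) :
    (1 + 2 * c * ⟨sliceEnd c 0, 0⟩ : ℂ) = 0 := by
  have := hc.1.ne'
  apply Complex.ext
  · simp [sliceEnd]
    field_simp
    ring
  · simp

theorem sliceBdry_zero {c : ℝ} (hc : c ∈ Ioo (0 : ℝ) 2) : sliceBdry c 0 = 0 := by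
  have := hc.1.ne'
  simp only [sliceBdry, powJ, hc.1.ne', if_false]
  rw [one_add_sliceEnd_zero hc, Complex.zero_cpow]
  simpa using this

theorem sliceBdry_eq {c : ℝ} (hc : c ∈ Ioo (0 : ℝ) 2) {v : ℝ} (hv : v ≠ 0) :
    ∃ σ : ℝ, |σ| = π / 2 ∧ sliceBdry c v =
      Complex.exp ⟨Real.log (2 * c * |v| / Real.sin (c * π / 2)) / c, σ⟩ := by
  obtain ⟨σ, hσ, hlog, hne, -⟩ := one_add_sliceEnd hc hv
  have hc0 := hc.1
  refine ⟨σ / c, by rw [abs_div, hσ, abs_of_pos hc0]; field_simp, ?_⟩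
  simp only [sliceBdry, powJ, hc.1.ne', if_false]
  rw [Complex.cpow_def_of_ne_zero hne, hlog]
  congr 1
  rw [show (1 / (c : ℂ)) = ((1 / c : ℝ) : ℂ) by push_cast; rfl]
  apply Complex.ext
  · rw [Complex.re_mul_ofReal]; simp only; ring
  · rw [Complex.im_mul_ofReal]; simp only; ring

theorem cos_eq_zero_of_abs {σ : ℝ} (h : |σ| = π / 2) : Real.cos σ = 0 := by
  rw [← Real.cos_abs, h, Real.cos_pi_div_two]

theorem re_sliceBdry {c : ℝ} (hc : c ∈ Ioo (0 : ℝ) 2) (v : ℝ) : (sliceBdry c v).re = 0 := by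
  by_cases hv : v = 0
  · rw [hv, sliceBdry_zero hc]; rfl
  · obtain ⟨σ, hσ, h⟩ := sliceBdry_eq hc hv
    rw [h, Complex.exp_re]
    simp [cos_eq_zero_of_abs hσ]

theorem sliceBdry_ne_zero {c : ℝ} (hc : c ∈ Ioo (0 : ℝ) 2) {v : ℝ} (hv : v ≠ 0) :
    sliceBdry c v ≠ 0 := by
  obtain ⟨σ, hσ, h⟩ := sliceBdry_eq hc hv
  rw [h]
  exact Complex.exp_ne_zero _

/-- Translates positions on the imaginary axis into heights; applied to the poles i·cot(kπ/n) it
produces the formula for the crevices. -/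
theorem abs_im_sliceBdry_rpow {c : ℝ} (hc : c ∈ Ioo (0 : ℝ) 2) {v : ℝ} (hv : v ≠ 0) :
    |v| = Real.sin (c * π / 2) * |(sliceBdry c v).im| ^ c / (2 * c) := by
  have hs := sin_angle_pos hc
  have hc0 := hc.1
  have hv' := abs_pos.2 hv
  obtain ⟨σ, hσ, h⟩ := sliceBdry_eq hc hv
  have hn : |(sliceBdry c v).im| = ‖sliceBdry c v‖ := by
    rw [Complex.abs_im_eq_norm]
    exact re_sliceBdry hc v
  rw [hn, h, Complex.norm_exp, ← Real.exp_mul]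
  simp only
  rw [div_mul_cancel₀ _ hc0.ne', Real.exp_log (by positivity)]
  field_simp

theorem continuousAt_powJ_sliceEnd {c : ℝ} (hc : c ∈ Ioo (0 : ℝ) 2) (v : ℝ) :
    ContinuousAt (powJ c) ⟨sliceEnd c v, v⟩ := by
  have hc0 := hc.1
  have hJ : powJ c = fun w => (1 + 2 * (c : ℂ) * w) ^ (1 / (c : ℂ)) := by
    funext w; simp only [powJ, hc.1.ne', if_false]
  rw [hJ]
  have hlin : ContinuousAt (fun w : ℂ => 1 + 2 * (c : ℂ) * w) ⟨sliceEnd c v, v⟩ := by fun_prop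
  by_cases hv : v = 0
  -- Height 0 is the vertex of the sector, on the branch cut; continuity survives because the
  -- exponent 1/c is positive.
  · subst hv
    have h : ContinuousAt (fun x : ℂ × ℂ => x.1 ^ x.2)
        (1 + 2 * (c : ℂ) * ⟨sliceEnd c 0, 0⟩, 1 / (c : ℂ)) := by
      rw [one_add_sliceEnd_zero hc]
      apply Complex.continuousAt_cpow_zero_of_re_pos
      rw [show (1 / (c : ℂ)) = ((1 / c : ℝ) : ℂ) by push_cast; rfl, Complex.ofReal_re]
      positivity
    exact h.comp (f := fun w : ℂ => (1 + 2 * (c : ℂ) * w, 1 / (c : ℂ)))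
      (hlin.prodMk continuousAt_const)
  · obtain ⟨σ, -, -, -, hslit⟩ := one_add_sliceEnd hc hv
    exact hlin.cpow continuousAt_const hslit

theorem continuous_sliceEnd (c : ℝ) : Continuous (sliceEnd c) := by
  unfold sliceEnd; fun_prop

theorem continuous_sliceBdry {c : ℝ} (hc : c ∈ Ioo (0 : ℝ) 2) : Continuous (sliceBdry c) := by
  rw [continuous_iff_continuousAt]
  intro v
  have h : ContinuousAt (fun v : ℝ => (⟨sliceEnd c v, v⟩ : ℂ)) v := by
    have : (fun v : ℝ => (⟨sliceEnd c v, v⟩ : ℂ)) = fun v : ℝ => (sliceEnd c v : ℂ) + v * Complex.I := by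
      funext v; rw [Complex.mk_eq_add_mul_I]
    rw [this]
    have := continuous_sliceEnd c
    fun_prop
  exact (continuousAt_powJ_sliceEnd hc v).comp (f := fun v : ℝ => (⟨sliceEnd c v, v⟩ : ℂ)) h

/-- At a boundary point of nonzero height, `powJ` crosses the imaginary axis transversally along
horizontal lines. -/
theorem hasDerivAt_powJ_sliceEnd {c : ℝ} (hc : c ∈ Ioo (0 : ℝ) 2) {v : ℝ} (hv : v ≠ 0) :
    ∃ D : ℂ, 0 < D.re ∧ HasDerivAt (powJ c) D ⟨sliceEnd c v, v⟩ := by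
  have hc0 := hc.1
  have hc' : (c : ℂ) ≠ 0 := by exact_mod_cast hc0.ne'
  obtain ⟨σ, hσ, hlog, hne, hslit⟩ := one_add_sliceEnd hc hv
  have hJ : powJ c = fun w => (1 + 2 * (c : ℂ) * w) ^ (1 / (c : ℂ)) := by
    funext w; simp only [powJ, hc.1.ne', if_false]
  have hd : HasDerivAt (fun w : ℂ => 1 + 2 * (c : ℂ) * w) (2 * c) ⟨sliceEnd c v, v⟩ := by
    simpa using ((hasDerivAt_id _).const_mul (2 * (c : ℂ))).const_add 1
  rw [hJ]
  refine ⟨_, ?_, hd.cpow_const hslit⟩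
  have hcoef : 1 / (c : ℂ) * (1 + 2 * c * ⟨sliceEnd c v, v⟩) ^ (1 / (c : ℂ) - 1) * (2 * c) =
      ((2 : ℝ) : ℂ) * (1 + 2 * c * ⟨sliceEnd c v, v⟩) ^ (1 / (c : ℂ) - 1) := by
    push_cast; field_simp
  rw [hcoef, Complex.re_ofReal_mul, Complex.cpow_def_of_ne_zero hne, hlog,
    show (1 / (c : ℂ) - 1) = ((1 / c - 1 : ℝ) : ℂ) by push_cast; rfl, Complex.exp_re,
    Complex.im_mul_ofReal]
  simp only
  -- Because |σ| = cπ/2, the argument of the derivative is ±(π/2 - cπ/2), within (-π/2, π/2) exactly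
  -- since 0 < c < 2.
  have hcos : Real.cos (σ * (1 / c - 1)) = Real.sin (c * π / 2) := by
    have : |σ * (1 / c - 1)| = |π / 2 - c * π / 2| := by
      rw [abs_mul, hσ, ← abs_of_pos (angle_bounds hc).1, ← abs_mul]
      congr 1
      rw [abs_of_pos (angle_bounds hc).1]
      field_simp
    rw [← Real.cos_abs, this, Real.cos_abs, Real.cos_pi_div_two_sub]
  rw [hcos]
  have := sin_angle_pos hc
  positivity

/-! ### The shear along horizontal slices: monotonicity, univalence and limits at the ends. -/

/-- `Φ` is the sum of the analytic and the co-analytic part of the shear of `powK c` with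
dilatation `zⁿ`, in the half-plane coordinate. -/
def IsShearSum (c : ℝ) (n : ℕ) (Φ : ℂ → ℂ) : Prop :=
  ∀ P ∈ rightHalf, HasDerivAt Φ (P ^ ((c : ℂ) - 1) / 2 * herglotz n P) P

/-- The harmonic mapping in the half-plane coordinate. -/
def shearMap (c : ℝ) (Φ : ℂ → ℂ) (P : ℂ) : ℂ := ⟨(Φ P).re, (powK c P).im⟩

/-- The real part of the harmonic mapping along the horizontal slice of `powRange c` at
height `v`. -/
def sliceFun (c : ℝ) (Φ : ℂ → ℂ) (v s : ℝ) : ℝ := (Φ (powJ c ⟨s, v⟩)).re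

/-- The horizontal slice of `powRange c` at height `v`. -/
def sliceSet (c v : ℝ) : Set ℝ := {s | (⟨s, v⟩ : ℂ) ∈ powRange c}

theorem sliceSet_of_mem_Ioo {c : ℝ} (hc : c ∈ Ioo (0 : ℝ) 2) (v : ℝ) :
    sliceSet c v = Ioi (sliceEnd c v) := by
  ext s; exact mem_powRange_iff hc

theorem sliceSet_zero {v : ℝ} (hv : |v| < π / 4) : sliceSet 0 v = univ :=
  eq_univ_of_forall fun _ => mem_powRange_zero.2 hv

theorem sliceSet_zero_of_le {v : ℝ} (hv : π / 4 ≤ |v|) : sliceSet 0 v = ∅ :=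
  eq_empty_of_forall_notMem fun _ h => (mem_powRange_zero.1 h).not_ge hv

theorem sliceSet_two {v : ℝ} (hv : v ≠ 0) : sliceSet 2 v = univ :=
  eq_univ_of_forall fun _ => mem_powRange_two.2 (Or.inl hv)

theorem sliceSet_two_zero : sliceSet 2 0 = Ioi (-(1 / 4)) := by
  ext s
  refine mem_powRange_two.trans ?_
  simp

theorem continuous_mk (v : ℝ) : Continuous fun s : ℝ => (⟨s, v⟩ : ℂ) := by
  have : (fun s : ℝ => (⟨s, v⟩ : ℂ)) = fun s : ℝ => (s : ℂ) + v * Complex.I := by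
    funext s; rw [Complex.mk_eq_add_mul_I]
  rw [this]
  fun_prop

theorem continuous_mk_right (s : ℝ) : Continuous fun v : ℝ => (⟨s, v⟩ : ℂ) := by
  have : (fun v : ℝ => (⟨s, v⟩ : ℂ)) = fun v : ℝ => (s : ℂ) + v * Complex.I := by
    funext v; rw [Complex.mk_eq_add_mul_I]
  rw [this]
  fun_prop

theorem hasDerivAt_mk (v s : ℝ) : HasDerivAt (fun s : ℝ => (⟨s, v⟩ : ℂ)) 1 s := by
  have : (fun s : ℝ => (⟨s, v⟩ : ℂ)) = fun s : ℝ => (s : ℂ) + v * Complex.I := by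
    funext s; rw [Complex.mk_eq_add_mul_I]
  rw [this]
  exact ((hasDerivAt_id s).ofReal_comp).add_const _

theorem isOpen_sliceSet (c v : ℝ) : IsOpen (sliceSet c v) :=
  (isOpen_powRange c).preimage (continuous_mk v)

theorem convex_sliceSet {c : ℝ} (hc : c ∈ Icc (0 : ℝ) 2) (v : ℝ) : Convex ℝ (sliceSet c v) := by
  rcases hc.1.eq_or_lt with rfl | h0
  · rcases lt_or_ge |v| (π / 4) with h | h
    · rw [sliceSet_zero h]; exact convex_univ
    · rw [sliceSet_zero_of_le h]; exact convex_empty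
  rcases hc.2.eq_or_lt with rfl | h2
  · by_cases hv : v = 0
    · rw [hv, sliceSet_two_zero]; exact convex_Ioi _
    · rw [sliceSet_two hv]; exact convex_univ
  · rw [sliceSet_of_mem_Ioo ⟨h0, h2⟩]; exact convex_Ioi _

section

variable {c : ℝ} {n : ℕ} {Φ : ℂ → ℂ}

/-- In the coordinate w = `powK c` P the factor P^(c-1)/2 cancels and only the kernel remains. Its
positive real part makes the shear increase along horizontal lines. -/
theorem IsShearSum.hasDerivAt_comp_powJ (hΦ : IsShearSum c n Φ) (hc : c ∈ Icc (0 : ℝ) 2)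
    {w : ℂ} (hw : w ∈ powRange c) :
    HasDerivAt (fun w => Φ (powJ c w)) (herglotz n (powJ c w)) w := by
  have hJ := powJ_mem hc hw
  refine ((hΦ _ hJ).comp w (hasDerivAt_powJ hc hw)).congr_deriv ?_
  have := deriv_powK_ne_zero c hJ
  rw [mul_right_comm, mul_inv_cancel₀ this, one_mul]

theorem IsShearSum.hasDerivAt_sliceFun (hΦ : IsShearSum c n Φ) (hc : c ∈ Icc (0 : ℝ) 2)
    {v s : ℝ} (hs : s ∈ sliceSet c v) :
    HasDerivAt (sliceFun c Φ v) (herglotz n (powJ c ⟨s, v⟩)).re s := by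
  have h : HasDerivAt (fun s : ℝ => Φ (powJ c ⟨s, v⟩)) (herglotz n (powJ c ⟨s, v⟩)) s := by
    have := (hΦ.hasDerivAt_comp_powJ hc hs).scomp s (hasDerivAt_mk v s)
    rw [one_smul] at this
    exact this
  have h2 := Complex.reCLM.hasFDerivAt.comp_hasDerivAt s h
  exact h2

theorem IsShearSum.continuousOn_sliceFun (hΦ : IsShearSum c n Φ) (hc : c ∈ Icc (0 : ℝ) 2)
    (v : ℝ) : ContinuousOn (sliceFun c Φ v) (sliceSet c v) :=
  fun _ hs => (hΦ.hasDerivAt_sliceFun hc hs).continuousAt.continuousWithinAt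

theorem IsShearSum.strictMonoOn_sliceFun (hΦ : IsShearSum c n Φ) (hc : c ∈ Icc (0 : ℝ) 2)
    (hn : 1 ≤ n) (v : ℝ) : StrictMonoOn (sliceFun c Φ v) (sliceSet c v) :=
  strictMonoOn_of_hasDerivAt_pos (convex_sliceSet hc v) (isOpen_sliceSet c v)
    (fun _ hs => hΦ.hasDerivAt_sliceFun hc hs)
    (fun _ hs => re_herglotz_pos hn (powJ_mem hc hs))

theorem mem_sliceSet_powK {P : ℂ} (hP : P ∈ rightHalf) :
    (powK c P).re ∈ sliceSet c (powK c P).im := ⟨P, hP, rfl⟩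

theorem sliceFun_powK (hc : c ∈ Icc (0 : ℝ) 2) {P : ℂ} (hP : P ∈ rightHalf) :
    sliceFun c Φ (powK c P).im (powK c P).re = (Φ P).re := by
  have : (⟨(powK c P).re, (powK c P).im⟩ : ℂ) = powK c P := rfl
  rw [sliceFun, this, powJ_powK hc hP]

/-- The shear preserves heights, so computing its range reduces to images of intervals under real
functions. -/
theorem mem_shearMap_image (hc : c ∈ Icc (0 : ℝ) 2) {w : ℂ} :
    w ∈ shearMap c Φ '' rightHalf ↔ w.re ∈ sliceFun c Φ w.im '' sliceSet c w.im := by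
  constructor
  · rintro ⟨P, hP, rfl⟩
    exact ⟨_, mem_sliceSet_powK hP, sliceFun_powK hc hP⟩
  · rintro ⟨s, hs, h⟩
    refine ⟨powJ c ⟨s, w.im⟩, powJ_mem hc hs, Complex.ext h ?_⟩
    simp only [shearMap]
    rw [powK_powJ hc hs]

theorem IsShearSum.injOn_shearMap (hΦ : IsShearSum c n Φ) (hc : c ∈ Icc (0 : ℝ) 2)
    (hn : 1 ≤ n) : InjOn (shearMap c Φ) rightHalf := by
  intro P hP Q hQ h
  have hre : (Φ P).re = (Φ Q).re := (Complex.ext_iff.1 h).1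
  have him : (powK c P).im = (powK c Q).im := (Complex.ext_iff.1 h).2
  have h1 := mem_sliceSet_powK (c := c) hP
  have h2 := mem_sliceSet_powK (c := c) hQ
  have h3 := sliceFun_powK (Φ := Φ) hc hP
  have h4 := sliceFun_powK (Φ := Φ) hc hQ
  rw [him] at h1 h3
  have h5 := (hΦ.strictMonoOn_sliceFun hc hn _).injOn h1 h2 (by rw [h3, h4, hre])
  rw [← powJ_powK hc hP, ← powJ_powK hc hQ, Complex.ext h5 him]

theorem IsShearSum.isPreconnected_line (hΦ : IsShearSum c n Φ) (hc : c ∈ Icc (0 : ℝ) 2) (y : ℝ) :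
    IsPreconnected (shearMap c Φ '' rightHalf ∩ {w : ℂ | w.im = y}) := by
  have : shearMap c Φ '' rightHalf ∩ {w : ℂ | w.im = y} =
      (fun u : ℝ => (⟨u, y⟩ : ℂ)) '' (sliceFun c Φ y '' sliceSet c y) := by
    ext w
    rw [mem_inter_iff, mem_shearMap_image hc]
    constructor
    · rintro ⟨h, rfl⟩
      exact ⟨w.re, h, rfl⟩
    · rintro ⟨u, h, rfl⟩
      exact ⟨h, rfl⟩
  rw [this]
  exact ((convex_sliceSet hc y).isPreconnected.image _ (hΦ.continuousOn_sliceFun hc y)).image _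
    (continuous_mk y).continuousOn

theorem powJ_zero (s v : ℝ) : powJ 0 ⟨s, v⟩ = Complex.exp ⟨2 * s, 2 * v⟩ := by
  simp only [powJ, if_true]
  congr 1
  apply Complex.ext <;> simp

/-- Far to the right at fixed height, |P| ≥ 1. The argument of P tends to 0 if c > 0, and is the
constant 2v with |2v| < π/2 if c = 0. -/
theorem re_powJ_eventually_ge (hc : c ∈ Icc (0 : ℝ) 2) {v : ℝ} (hv : c = 0 → |v| < π / 4) :
    ∃ δ > 0, ∀ᶠ s : ℝ in atTop, δ ≤ (powJ c ⟨s, v⟩).re := by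
  rcases hc.1.eq_or_lt with rfl | h0
  · have hv' := abs_lt.1 (hv rfl)
    have hcos : 0 < Real.cos (2 * v) :=
      Real.cos_pos_of_mem_Ioo ⟨by linarith, by linarith⟩
    refine ⟨_, hcos, ?_⟩
    filter_upwards [eventually_ge_atTop 0] with s hs
    rw [powJ_zero, Complex.exp_re]
    have := Real.one_le_exp (x := 2 * s) (by linarith)
    simp only
    nlinarith
  · have hc' : (c : ℂ) ≠ 0 := by exact_mod_cast h0.ne'
    have hre : ∀ s : ℝ, (1 + 2 * (c : ℂ) * ⟨s, v⟩).re = 1 + 2 * c * s := by intro s; simp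
    have him : ∀ s : ℝ, (1 + 2 * (c : ℂ) * ⟨s, v⟩).im = 2 * c * v := by intro s; simp
    have hre_top : Tendsto (fun s : ℝ => 1 + 2 * c * s) atTop atTop :=
      tendsto_atTop_add_const_left _ _ (tendsto_id.const_mul_atTop (by positivity))
    have hnorm : Tendsto (fun s : ℝ => ‖1 + 2 * (c : ℂ) * ⟨s, v⟩‖) atTop atTop := by
      refine tendsto_atTop_mono (fun s => ?_) hre_top
      rw [← hre s]
      exact Complex.re_le_norm _
    have harg : Tendsto (fun s : ℝ => Complex.arg (1 + 2 * (c : ℂ) * ⟨s, v⟩) / c) atTop (𝓝 0) := by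
      have h1 : Tendsto (fun s : ℝ => Real.arcsin (2 * c * v / ‖1 + 2 * (c : ℂ) * ⟨s, v⟩‖) / c)
          atTop (𝓝 (Real.arcsin 0 / c)) :=
        ((Real.continuous_arcsin.tendsto 0).comp (hnorm.const_div_atTop (2 * c * v))).div_const c
      rw [Real.arcsin_zero, zero_div] at h1
      refine h1.congr' ?_
      filter_upwards [hre_top.eventually_ge_atTop 0] with s hs
      rw [Complex.arg_of_re_nonneg (by rw [hre]; exact hs), him]
    have hcos := (Real.continuous_cos.tendsto 0).comp harg
    rw [Real.cos_zero] at hcos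
    refine ⟨1 / 2, by norm_num, ?_⟩
    filter_upwards [hcos.eventually_const_le (show (1 / 2 : ℝ) < 1 by norm_num),
      hnorm.eventually_ge_atTop 1] with s h1 h2
    have hne : 1 + 2 * (c : ℂ) * ⟨s, v⟩ ≠ 0 := norm_pos_iff.1 (by linarith)
    simp only [powJ, h0.ne', if_false]
    rw [Complex.cpow_def_of_ne_zero hne, show (1 / (c : ℂ)) = ((1 / c : ℝ) : ℂ) by push_cast; rfl,
      Complex.exp_re, Complex.re_mul_ofReal, Complex.im_mul_ofReal, Complex.log_re, Complex.log_im]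
    simp only [Function.comp] at h1
    rw [mul_one_div (Complex.arg _)]
    have h3 : 1 ≤ Real.exp (Real.log ‖1 + 2 * (c : ℂ) * ⟨s, v⟩‖ * (1 / c)) :=
      Real.one_le_exp (mul_nonneg (Real.log_nonneg h2) (by positivity))
    nlinarith

theorem eventually_mem_sliceSet_atTop (hc : c ∈ Icc (0 : ℝ) 2) {v : ℝ}
    (hv : c = 0 → |v| < π / 4) : ∃ a, Ioi a ⊆ sliceSet c v := by
  rcases hc.1.eq_or_lt with rfl | h0
  · rw [sliceSet_zero (hv rfl)]; exact ⟨0, subset_univ _⟩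
  rcases hc.2.eq_or_lt with rfl | h2
  · by_cases hv : v = 0
    · rw [hv, sliceSet_two_zero]; exact ⟨_, Subset.rfl⟩
    · rw [sliceSet_two hv]; exact ⟨0, subset_univ _⟩
  · rw [sliceSet_of_mem_Ioo ⟨h0, h2⟩]; exact ⟨_, Subset.rfl⟩

theorem IsShearSum.tendsto_sliceFun_atTop (hΦ : IsShearSum c n Φ) (hc : c ∈ Icc (0 : ℝ) 2)
    (hn : 1 ≤ n) {v : ℝ} (hv : c = 0 → |v| < π / 4) :
    Tendsto (sliceFun c Φ v) atTop atTop := by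
  obtain ⟨δ, hδ, h⟩ := re_powJ_eventually_ge hc hv
  obtain ⟨a, ha⟩ := eventually_mem_sliceSet_atTop hc hv
  obtain ⟨b, hb⟩ := eventually_atTop.1 h
  have hn' : (0 : ℝ) < n := by exact_mod_cast hn
  refine tendsto_atTop_of_le_hasDerivAt (a := max a b) (div_pos hδ hn')
    (fun s hs => hΦ.hasDerivAt_sliceFun hc (ha ((le_max_left a b).trans_lt hs))) (fun s hs => ?_)
  refine le_trans ?_ (re_div_le_re_herglotz hn
    (powJ_mem hc (ha ((le_max_left a b).trans_lt hs))))
  gcongr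
  exact hb s ((le_max_right a b).trans (le_of_lt hs))

/-- The pole at P = 0 gives the bound Re(1/P) = e^(-2s) cos 2v ≥ cos 2v for s < 0, hence at least
linear descent. -/
theorem IsShearSum.tendsto_sliceFun_zero_atBot (hΦ : IsShearSum 0 n Φ) (hn : 1 ≤ n)
    (he : Even n) {v : ℝ} (hv : |v| < π / 4) : Tendsto (sliceFun 0 Φ v) atBot atBot := by
  have hc : (0 : ℝ) ∈ Icc (0 : ℝ) 2 := by simp
  have hv' := abs_lt.1 hv
  have hn' : (0 : ℝ) < n := by exact_mod_cast hn
  have hcos : 0 < Real.cos (2 * v) :=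
    Real.cos_pos_of_mem_Ioo ⟨by linarith, by linarith⟩
  have hmem : ∀ s, s ∈ sliceSet 0 v := by rw [sliceSet_zero hv]; exact fun s => mem_univ s
  refine tendsto_atBot_of_le_hasDerivAt (a := 0) (div_pos hcos hn')
    (fun s hs => hΦ.hasDerivAt_sliceFun hc (hmem s)) (fun s hs => ?_)
  refine le_trans ?_ (re_inv_le_re_herglotz hn he (powJ_mem hc (hmem s)))
  gcongr
  rw [powJ_zero, ← Complex.exp_neg, Complex.exp_re]
  simp only [Complex.neg_re, Complex.neg_im, Real.cos_neg]
  have hs' : s < 0 := hs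
  have := Real.one_le_exp (x := -(2 * s)) (by linarith)
  nlinarith

/-- Here P is the square root of 1 + 4w, and Re P decays only like |s|^(-1/2) as s → -∞. The pole at
P = ∞ therefore already forces divergence, whatever the parity of n. -/
theorem IsShearSum.tendsto_sliceFun_two_atBot (hΦ : IsShearSum 2 n Φ) (hn : 1 ≤ n)
    {v : ℝ} (hv : v ≠ 0) : Tendsto (sliceFun 2 Φ v) atBot atBot := by
  have hc : (2 : ℝ) ∈ Icc (0 : ℝ) 2 := by simp
  have hn' : (0 : ℝ) < n := by exact_mod_cast hn
  have hmem : ∀ s, s ∈ sliceSet 2 v := by rw [sliceSet_two hv]; exact fun s => mem_univ s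
  have hv' := abs_pos.2 hv
  -- A crude bound suffices: Re P · |Im P| = 2|v|, and below this threshold |Im P| ≤ |Im P|² ≤ 8|s|,
  -- so Re P ≥ |v|/(4|s|).
  refine tendsto_atBot_of_div_neg_le_hasDerivAt (a := -(1 + |v|)) (δ := |v| / 4 / n)
    (by positivity) (by linarith)
    (fun s hs => hΦ.hasDerivAt_sliceFun hc (hmem s)) (fun s hs => ?_)
  have hs' : s < -(1 + |v|) := hs
  have hP := powJ_mem hc (hmem s)
  refine le_trans ?_ (re_div_le_re_herglotz hn hP)
  rw [div_right_comm]
  gcongr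
  have hsq : powJ 2 ⟨s, v⟩ ^ 2 = 1 + 4 * ⟨s, v⟩ := by
    simp only [powJ, if_neg (two_ne_zero (α := ℝ))]
    have := Complex.cpow_nat_inv_pow (1 + 2 * ((2 : ℝ) : ℂ) * ⟨s, v⟩) (n := 2) (by norm_num)
    push_cast at this ⊢
    rw [one_div, this]
    ring
  set P := powJ 2 ⟨s, v⟩
  have hP' : 0 < P.re := hP
  have h1 : P.re ^ 2 - P.im ^ 2 = 1 + 4 * s := by
    have := congrArg Complex.re hsq
    simp [pow_two] at this
    linarith
  have h2 : P.re * P.im = 2 * v := by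
    have := congrArg Complex.im hsq
    simp [pow_two] at this
    linarith
  have h3 : P.re * |P.im| = 2 * |v| := by
    rw [← abs_of_pos hP', ← abs_mul, h2, abs_mul, abs_two]
  have h4 : 1 + 4 * |v| ≤ P.im ^ 2 := by nlinarith
  have h5 : 1 ≤ |P.im| := by
    by_contra hcon
    rw [← sq_abs] at h4
    nlinarith [abs_nonneg P.im]
  have h6 : P.re ^ 2 ≤ |v| := by
    have h7 : P.re ^ 2 * P.im ^ 2 = 4 * |v| ^ 2 := by
      rw [← mul_pow, h2, mul_pow, sq_abs]; norm_num
    have h8 : P.re ^ 2 * (4 * |v|) ≤ |v| * (4 * |v|) := by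
      nlinarith [mul_nonneg (sq_nonneg P.re) (sub_nonneg.2 h4), sq_nonneg P.re]
    exact le_of_mul_le_mul_right h8 (by positivity)
  have h7 : |P.im| ≤ -(8 * s) := by
    have : |P.im| ≤ P.im ^ 2 := by rw [← sq_abs]; nlinarith
    linarith
  rw [div_div, div_le_iff₀ (by linarith)]
  nlinarith [mul_le_mul_of_nonneg_left h7 hP'.le]

end

/-! ### Boundary values of the shear, and the boundary function for 0 < c < 2. -/

section
variable {c : ℝ} {n : ℕ} {Φ : ℂ → ℂ}

theorem continuousAt_cpow_const_of_mem_slitPlane {b : ℂ} (hb : b ∈ Complex.slitPlane) (a : ℂ) :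
    ContinuousAt (fun P : ℂ => P ^ a) b :=
  continuousAt_id.cpow continuousAt_const hb

/-- The harmonic mapping extends continuously to a boundary point that is not a pole of the
Herglotz kernel. -/
theorem IsShearSum.exists_tendsto_of_ne_zero (hΦ : IsShearSum c n Φ) {b : ℂ} (hb : b.re = 0)
    (hb0 : b ≠ 0) (hbn : cayleyInv b ^ n ≠ 1) :
    ∃ ℓ : ℝ, Tendsto (fun P => (Φ P).re) (𝓝[rightHalf] b) (𝓝 ℓ) := by
  have hslit : b ∈ Complex.slitPlane := by
    refine Complex.mem_slitPlane_iff.2 (Or.inr fun h => hb0 (Complex.ext hb h))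
  have hcont : ContinuousAt (fun P : ℂ => P ^ ((c : ℂ) - 1) / 2 * herglotz n P) b :=
    ((continuousAt_cpow_const_of_mem_slitPlane hslit _).div_const 2).mul
      (continuousAt_herglotz (add_one_ne_zero_of_re_nonneg hb.ge) (sub_ne_zero.2 hbn.symm))
  refine exists_tendsto_re_of_hasDerivAt_bounded convex_rightHalf hΦ
    (C := ‖b ^ ((c : ℂ) - 1) / 2 * herglotz n b‖ + 1) ?_
  exact nhdsWithin_le_nhds
    ((hcont.norm.eventually_lt_const (lt_add_one _)).mono fun _ => le_of_lt)

theorem norm_cpow_sub_one (P : ℂ) :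
    ‖P ^ ((c : ℂ) - 1)‖ = ‖P‖ ^ (c - 1) := by
  rw [show (c : ℂ) - 1 = ((c - 1 : ℝ) : ℂ) by push_cast; rfl, Complex.norm_cpow_real]

theorem eventually_norm_lt_one : ∀ᶠ P : ℂ in 𝓝[rightHalf] 0, ‖P‖ < 1 :=
  nhdsWithin_le_nhds ((continuous_norm.tendsto (0 : ℂ)).eventually_lt_const (by simp))

/-- The zero of the kernel compensates P^(c-1): the derivative is O(|P|^c), bounded even for c = 0.
-/
theorem IsShearSum.exists_tendsto_zero_of_odd (hΦ : IsShearSum c n Φ) (hc : 0 ≤ c)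
    (hn : Odd n) :
    ∃ ℓ : ℝ, Tendsto (fun P => (Φ P).re) (𝓝[rightHalf] 0) (𝓝 ℓ) := by
  obtain ⟨C, hC⟩ := herglotz_isBigO_of_odd hn
  refine exists_tendsto_re_of_hasDerivAt_bounded convex_rightHalf hΦ (C := |C|) ?_
  filter_upwards [hC, eventually_norm_lt_one, self_mem_nhdsWithin] with P hP hP1 hPH
  have hP0 := ne_zero_of_mem_rightHalf hPH
  have hpos := norm_pos_iff.2 hP0
  rw [norm_mul, norm_div, norm_cpow_sub_one]
  have h1 : ‖P‖ ^ (c - 1) * ‖P‖ ≤ 1 := by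
    nth_rewrite 2 [← Real.rpow_one ‖P‖]
    rw [← Real.rpow_add hpos]
    exact Real.rpow_le_one hpos.le hP1.le (by linarith)
  have h0 : 0 ≤ ‖P‖ ^ (c - 1) := by positivity
  calc ‖P‖ ^ (c - 1) / ‖(2 : ℂ)‖ * ‖herglotz n P‖
      ≤ ‖P‖ ^ (c - 1) / ‖(2 : ℂ)‖ * (|C| * ‖P‖) := by
        gcongr
        exact hP.trans (by gcongr; exact le_abs_self C)
    _ = |C| * ((‖P‖ ^ (c - 1) * ‖P‖) / 2) := by rw [Complex.norm_two]; ring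
    _ ≤ |C| * 1 := by gcongr; linarith
    _ = |C| := mul_one _

/-- The singular part aP^(c-2)/2 of the derivative has the primitive aP^(c-1)/(2(c-1)), continuous
at 0 because c > 1; the remainder has bounded derivative. -/
theorem IsShearSum.exists_tendsto_zero_of_one_lt (hΦ : IsShearSum c n Φ) (hc : 1 < c)
    (hn : 1 ≤ n) :
    ∃ ℓ : ℝ, Tendsto (fun P => (Φ P).re) (𝓝[rightHalf] 0) (𝓝 ℓ) := by
  obtain ⟨a, C, hC⟩ := herglotz_sub_div_bounded hn
  have hc1 : (c : ℂ) - 1 ≠ 0 := by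
    rw [sub_ne_zero]; exact_mod_cast hc.ne'
  set G : ℂ → ℂ := fun P => a / (2 * ((c : ℂ) - 1)) * P ^ ((c : ℂ) - 1) with hG
  have hdG : ∀ P ∈ rightHalf, HasDerivAt G (P ^ ((c : ℂ) - 1) / 2 * (a / P)) P := by
    intro P hP
    have hP0 := ne_zero_of_mem_rightHalf hP
    refine (((hasDerivAt_id P).cpow_const (rightHalf_subset_slitPlane hP)).const_mul
      (a / (2 * ((c : ℂ) - 1)))).congr_deriv ?_
    simp only [id, mul_one]
    rw [Complex.cpow_sub _ _ hP0, Complex.cpow_one]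
    field_simp
  have hd : ∀ P ∈ rightHalf, HasDerivAt (fun P => Φ P - G P)
      (P ^ ((c : ℂ) - 1) / 2 * (herglotz n P - a / P)) P := by
    intro P hP
    refine ((hΦ P hP).sub (hdG P hP)).congr_deriv ?_
    ring
  obtain ⟨ℓ, hℓ⟩ := exists_tendsto_re_of_hasDerivAt_bounded convex_rightHalf hd (b := 0)
    (C := |C|) (by
      filter_upwards [hC, eventually_norm_lt_one, self_mem_nhdsWithin] with P hP hP1 hPH
      have hP0 := ne_zero_of_mem_rightHalf hPH
      have hpos := norm_pos_iff.2 hP0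
      rw [norm_mul, norm_div, norm_cpow_sub_one, Complex.norm_two]
      have h1 : ‖P‖ ^ (c - 1) ≤ 1 := Real.rpow_le_one hpos.le hP1.le (by linarith)
      have h0 : 0 ≤ ‖P‖ ^ (c - 1) := by positivity
      have h2 := hP.trans (le_abs_self C)
      have h3 := norm_nonneg (herglotz n P - a / P)
      nlinarith)
  have hGc : Tendsto G (𝓝[rightHalf] 0) (𝓝 (G 0)) := by
    have h : ContinuousAt (fun x : ℂ × ℂ => x.1 ^ x.2) (0, (c : ℂ) - 1) :=
      Complex.continuousAt_cpow_zero_of_re_pos (by simpa using hc)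
    have h2 : ContinuousAt (fun P : ℂ => P ^ ((c : ℂ) - 1)) 0 :=
      h.comp (f := fun P : ℂ => (P, (c : ℂ) - 1)) (continuousAt_id.prodMk continuousAt_const)
    exact (h2.const_mul _).tendsto.mono_left nhdsWithin_le_nhds
  refine ⟨ℓ + (G 0).re, (hℓ.add ((Complex.continuous_re.tendsto _).comp hGc)).congr fun P => ?_⟩
  simp

/-- The set of points of the imaginary axis where the harmonic mapping is unbounded. -/
def IsCrevice (c : ℝ) (n : ℕ) (b : ℂ) : Prop :=
  if b = 0 then Even n ∧ c ≤ 1 else cayleyInv b ^ n = 1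

theorem IsShearSum.exists_tendsto (hΦ : IsShearSum c n Φ) (hc : c ∈ Icc (0 : ℝ) 2)
    (hn : 1 ≤ n) {b : ℂ} (hb : b.re = 0) (h : ¬ IsCrevice c n b) :
    ∃ ℓ : ℝ, Tendsto (fun P => (Φ P).re) (𝓝[rightHalf] b) (𝓝 ℓ) := by
  by_cases hb0 : b = 0
  · rw [IsCrevice, if_pos hb0, not_and_or, Nat.not_even_iff_odd, not_le] at h
    subst hb0
    rcases h with h | h
    · exact hΦ.exists_tendsto_zero_of_odd hc.1 h
    · exact hΦ.exists_tendsto_zero_of_one_lt h hn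
  · rw [IsCrevice, if_neg hb0] at h
    exact hΦ.exists_tendsto_of_ne_zero hb hb0 h

theorem tendsto_powJ_sliceEnd (hc : c ∈ Ioo (0 : ℝ) 2) (v : ℝ) :
    Tendsto (fun s : ℝ => powJ c ⟨s, v⟩) (𝓝[>] sliceEnd c v) (𝓝[rightHalf] sliceBdry c v) := by
  refine tendsto_nhdsWithin_iff.2 ⟨?_, ?_⟩
  · have : ContinuousAt (fun s : ℝ => powJ c ⟨s, v⟩) (sliceEnd c v) :=
      (continuousAt_powJ_sliceEnd hc v).comp (f := fun s : ℝ => (⟨s, v⟩ : ℂ))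
        (continuous_mk v).continuousAt
    exact this.tendsto.mono_left nhdsWithin_le_nhds
  · filter_upwards [self_mem_nhdsWithin] with s hs
    exact powJ_mem (Ioo_subset_Icc_self hc) ((mem_powRange_iff hc).2 hs)

/-- Let a be the left end and b the pole. If b ≠ 0, then P - b ~ D(s - a) with Re D > 0, so the pole
contributes about Re(1/D)/(s - a). If b = 0, then P is the power 1/c of a multiple of s - a, and 1/P
still dominates 1/(s - a) because c ≤ 1. -/
theorem IsShearSum.tendsto_sliceFun_of_isCrevice (hΦ : IsShearSum c n Φ)
    (hc : c ∈ Ioo (0 : ℝ) 2) (hn : 1 ≤ n) {v : ℝ} (h : IsCrevice c n (sliceBdry c v)) :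
    Tendsto (sliceFun c Φ v) (𝓝[>] sliceEnd c v) atBot := by
  have hc' := Ioo_subset_Icc_self hc
  have hn' : (0 : ℝ) < n := by exact_mod_cast hn
  have hc0 := hc.1
  have hmem : ∀ s, sliceEnd c v < s → s ∈ sliceSet c v := by
    rw [sliceSet_of_mem_Ioo hc]; exact fun _ hs => hs
  -- It suffices to bound the Herglotz kernel from below near the end of the slice.
  suffices hbd : ∃ δ > 0, ∀ᶠ s in 𝓝[>] sliceEnd c v,
      δ / (s - sliceEnd c v) ≤ (herglotz n (powJ c ⟨s, v⟩)).re by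
    obtain ⟨δ, hδ, hs⟩ := hbd
    obtain ⟨b, hb, hs⟩ := (mem_nhdsGT_iff_exists_Ioo_subset).1 hs
    exact tendsto_nhdsGT_atBot_of_le_hasDerivAt hδ hb
      (fun s hs' => hΦ.hasDerivAt_sliceFun hc' (hmem s hs'.1)) hs
  by_cases hv : v = 0
  · subst hv
    rw [IsCrevice, if_pos (sliceBdry_zero hc)] at h
    refine ⟨1 / (2 * c) / n, by positivity, ?_⟩
    have ha : sliceEnd c 0 = -(1 / (2 * c)) := by simp [sliceEnd]
    rw [ha]
    filter_upwards [Ioo_mem_nhdsGT (show -(1 / (2 * c)) < 0 by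
      rw [neg_lt_zero]; positivity)] with s hs
    have hs1 : sliceEnd c 0 < s := by rw [ha]; exact hs.1
    refine le_trans ?_ (re_inv_le_re_herglotz hn h.1 (powJ_mem hc' (hmem s hs1)))
    rw [div_right_comm]
    gcongr
    set x := 1 + 2 * c * s with hx
    have hx0 : 0 < x := by
      have := hs.1
      rw [neg_lt, ← sub_pos] at this
      have h2 : x = 2 * c * (1 / (2 * c) - -s) := by rw [hx]; field_simp; ring
      rw [h2]; positivity
    have hx1 : x ≤ 1 := by
      have := hs.2
      rw [hx]; nlinarith
    have hJ : powJ c ⟨s, 0⟩ = ((x ^ (1 / c) : ℝ) : ℂ) := by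
      simp only [powJ, hc0.ne', if_false]
      have : (1 + 2 * (c : ℂ) * ⟨s, 0⟩) = ((x : ℝ) : ℂ) := by
        apply Complex.ext <;> simp [hx]
      rw [this, Complex.ofReal_cpow hx0.le]
      push_cast; rfl
    rw [hJ, ← Complex.ofReal_inv, Complex.ofReal_re]
    have h3 : 1 / (2 * c) / (s - -(1 / (2 * c))) = x⁻¹ := by
      have : s - -(1 / (2 * c)) = x / (2 * c) := by rw [hx]; field_simp; ring
      rw [this]; field_simp
    rw [h3]
    apply inv_anti₀ (by positivity)
    calc x ^ (1 / c) ≤ x ^ (1 : ℝ) := by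
          apply Real.rpow_le_rpow_of_exponent_ge hx0 hx1
          rw [le_div_iff₀ hc0]; linarith [h.2]
      _ = x := Real.rpow_one x
  · rw [IsCrevice, if_neg (sliceBdry_ne_zero hc hv)] at h
    obtain ⟨D, hD, hder⟩ := hasDerivAt_powJ_sliceEnd hc hv
    have hD0 : D ≠ 0 := fun h => by rw [h] at hD; simp at hD
    have hder' : HasDerivAt (fun s : ℝ => powJ c ⟨s, v⟩) D (sliceEnd c v) := by
      have := hder.scomp (sliceEnd c v) (hasDerivAt_mk v (sliceEnd c v))
      rw [one_smul] at this
      exact this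
    have hslope := (hasDerivAt_iff_tendsto_slope.1 hder').mono_left
      (nhdsWithin_mono _ (fun s (hs : sliceEnd c v < s) => ne_of_gt hs))
    have hinv := (Complex.continuous_re.tendsto _).comp (hslope.inv₀ hD0)
    have hDpos : 0 < (D⁻¹).re := by
      rw [Complex.inv_re]
      exact div_pos hD (Complex.normSq_pos.2 hD0)
    refine ⟨(D⁻¹).re / 2 / n, by positivity, ?_⟩
    filter_upwards [hinv.eventually_const_le (half_lt_self hDpos), self_mem_nhdsWithin]
      with s hs hsa
    have hsa' : 0 < s - sliceEnd c v := sub_pos.2 hsa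
    refine le_trans ?_ (re_inv_sub_le_re_herglotz hn (powJ_mem hc' (hmem s hsa))
      (re_sliceBdry hc v) h)
    rw [div_right_comm]
    gcongr
    rw [div_le_iff₀ hsa']
    refine hs.trans (le_of_eq ?_)
    simp only [Function.comp]
    rw [slope_def_module, smul_inv₀, inv_inv]
    change ((s - sliceEnd c v) • (powJ c ⟨s, v⟩ - sliceBdry c v)⁻¹).re = _
    rw [Complex.real_smul, Complex.re_ofReal_mul, mul_comm]

/-- The boundary function of the range. -/
def boundaryFun (c : ℝ) (Φ : ℂ → ℂ) (v : ℝ) : ℝ :=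
  extendFrom rightHalf (fun P => (Φ P).re) (sliceBdry c v)

theorem mem_closure_rightHalf {b : ℂ} (hb : b.re = 0) : b ∈ closure rightHalf := by
  have : closure rightHalf = {z : ℂ | 0 ≤ z.re} := Complex.closure_setOfPred_lt_re 0
  rw [this]
  exact hb.ge

/-- The limits exist within the full half-plane, not merely along slices, so the extension by limits
is continuous on the boundary points that are not crevices. -/
theorem IsShearSum.continuousOn_boundaryFun (hΦ : IsShearSum c n Φ) (hc : c ∈ Ioo (0 : ℝ) 2)
    (hn : 1 ≤ n) :
    ContinuousOn (boundaryFun c Φ) {v | ¬ IsCrevice c n (sliceBdry c v)} := by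
  have h := continuousOn_extendFrom (A := rightHalf) (f := fun P => (Φ P).re)
    (B := {b | b.re = 0 ∧ ¬ IsCrevice c n b}) (fun b hb => mem_closure_rightHalf hb.1)
    (fun b hb => hΦ.exists_tendsto (Ioo_subset_Icc_self hc) hn hb.1 hb.2)
  exact h.comp (continuous_sliceBdry hc).continuousOn fun v hv => ⟨re_sliceBdry hc v, hv⟩

theorem IsShearSum.tendsto_sliceFun_boundaryFun (hΦ : IsShearSum c n Φ)
    (hc : c ∈ Ioo (0 : ℝ) 2) (hn : 1 ≤ n) {v : ℝ} (h : ¬ IsCrevice c n (sliceBdry c v)) :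
    Tendsto (sliceFun c Φ v) (𝓝[>] sliceEnd c v) (𝓝 (boundaryFun c Φ v)) :=
  (tendsto_extendFrom (hΦ.exists_tendsto (Ioo_subset_Icc_self hc) hn (re_sliceBdry hc v) h)).comp
    (tendsto_powJ_sliceEnd hc v)

theorem IsShearSum.image_sliceFun_of_not_isCrevice (hΦ : IsShearSum c n Φ)
    (hc : c ∈ Ioo (0 : ℝ) 2) (hn : 1 ≤ n) {v : ℝ} (h : ¬ IsCrevice c n (sliceBdry c v)) :
    sliceFun c Φ v '' sliceSet c v = Ioi (boundaryFun c Φ v) := by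
  have hc' := Ioo_subset_Icc_self hc
  have hlim := hΦ.tendsto_sliceFun_boundaryFun hc hn h
  have hset := sliceSet_of_mem_Ioo hc v
  refine image_eq_Ioi_of_tendsto (convex_sliceSet hc' v).isPreconnected
    (hΦ.continuousOn_sliceFun hc' v) (l₁ := 𝓝[>] sliceEnd c v) (l₂ := atTop) ?_ ?_ hlim
    (hΦ.tendsto_sliceFun_atTop hc' hn (fun h => absurd h hc.1.ne')) fun s hs => ?_
  · rw [hset]; exact self_mem_nhdsWithin
  · rw [hset]; exact Ioi_mem_atTop _
  · refine lt_of_strictMonoOn_of_tendsto (hΦ.strictMonoOn_sliceFun hc' hn v) hlim ?_ hs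
    intro s hs
    rw [hset] at hs ⊢
    have hs' : sliceEnd c v < s := hs
    refine ⟨(sliceEnd c v + s) / 2, by simp only [mem_Ioi]; linarith, by linarith, ?_⟩
    filter_upwards [Ioo_mem_nhdsGT (show sliceEnd c v < (sliceEnd c v + s) / 2 by linarith)]
      with r hr
    exact ⟨hr.1, hr.2.le⟩

theorem IsShearSum.image_sliceFun_of_isCrevice (hΦ : IsShearSum c n Φ)
    (hc : c ∈ Ioo (0 : ℝ) 2) (hn : 1 ≤ n) {v : ℝ} (h : IsCrevice c n (sliceBdry c v)) :
    sliceFun c Φ v '' sliceSet c v = univ := by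
  have hc' := Ioo_subset_Icc_self hc
  have hset := sliceSet_of_mem_Ioo hc v
  refine image_eq_univ_of_tendsto (convex_sliceSet hc' v).isPreconnected
    (hΦ.continuousOn_sliceFun hc' v) (l₁ := 𝓝[>] sliceEnd c v) (l₂ := atTop) ?_ ?_
    (hΦ.tendsto_sliceFun_of_isCrevice hc hn h)
    (hΦ.tendsto_sliceFun_atTop hc' hn (fun h => absurd h hc.1.ne'))
  · rw [hset]; exact self_mem_nhdsWithin
  · rw [hset]; exact Ioi_mem_atTop _

theorem IsShearSum.boundaryFun_lt (hΦ : IsShearSum c n Φ)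
    (hc : c ∈ Ioo (0 : ℝ) 2) (hn : 1 ≤ n) {v s : ℝ} (h : ¬ IsCrevice c n (sliceBdry c v))
    (hs : s ∈ sliceSet c v) : boundaryFun c Φ v < sliceFun c Φ v s := by
  have := mem_image_of_mem (sliceFun c Φ v) hs
  rwa [hΦ.image_sliceFun_of_not_isCrevice hc hn h] at this

/-- At a crevice the boundary function tends to `-∞`. -/
theorem IsShearSum.tendsto_boundaryFun_of_isCrevice (hΦ : IsShearSum c n Φ)
    (hc : c ∈ Ioo (0 : ℝ) 2) (hn : 1 ≤ n) {e : ℝ} (he : IsCrevice c n (sliceBdry c e))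
    (hev : ∀ᶠ v in 𝓝[≠] e, ¬ IsCrevice c n (sliceBdry c v)) :
    Tendsto (boundaryFun c Φ) (𝓝[≠] e) atBot := by
  have hc' := Ioo_subset_Icc_self hc
  refine tendsto_atBot.2 fun M => ?_
  -- The crevice slice maps onto the whole line. A point mapped left of `M` keeps this property at
  -- nearby heights, and there the boundary value lies still further left.
  obtain ⟨s, hs, hsM⟩ : ∃ s ∈ sliceSet c e, sliceFun c Φ e s < M := by
    have hM : M - 1 ∈ sliceFun c Φ e '' sliceSet c e := by
      rw [hΦ.image_sliceFun_of_isCrevice hc hn he]; exact mem_univ _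
    obtain ⟨s, hs, h⟩ := hM
    exact ⟨s, hs, by linarith⟩
  have hcont : ContinuousAt (fun v : ℝ => sliceFun c Φ v s) e := by
    have h1 := (hΦ.hasDerivAt_comp_powJ hc' hs).continuousAt
    exact Complex.continuous_re.continuousAt.comp
      (h1.comp (f := fun v : ℝ => (⟨s, v⟩ : ℂ)) (continuous_mk_right s).continuousAt)
  have hmem : ∀ᶠ v in 𝓝 e, s ∈ sliceSet c v :=
    (continuous_mk_right s).continuousAt.eventually_mem ((isOpen_powRange c).mem_nhds hs)
  filter_upwards [hev, nhdsWithin_le_nhds hmem,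
    nhdsWithin_le_nhds (hcont.eventually_lt_const hsM)] with v h1 h2 h3
  exact ((hΦ.boundaryFun_lt hc hn h1 h2).trans h3).le

/-- Along the rays of argument `θ` with `π / 2 < (c + 1) |θ| < 3 π / 2` the harmonic mapping
tends to `-∞` in the horizontal direction. -/
theorem IsShearSum.tendsto_ray (hΦ : IsShearSum c n Φ) (hc : 0 ≤ c)
    (hn : 1 ≤ n) {θ : ℝ} (hθ : |θ| < π / 2) (hcos : Real.cos ((c + 1) * θ) < 0) :
    Tendsto (fun r : ℝ => (Φ (r * Complex.exp (θ * Complex.I))).re) atTop atBot := by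
  have hn' : (0 : ℝ) < n := by exact_mod_cast hn
  set u := Complex.exp (θ * Complex.I) with hu
  have hu0 : u ≠ 0 := Complex.exp_ne_zero _
  have hmem : ∀ r : ℝ, 0 < r → (r : ℂ) * u ∈ rightHalf := by
    intro r hr
    change 0 < ((r : ℂ) * u).re
    rw [Complex.re_ofReal_mul, hu, Complex.exp_ofReal_mul_I_re]
    obtain ⟨h1, h2⟩ := abs_lt.1 hθ
    have := Real.cos_pos_of_mem_Ioo ⟨by linarith, h2⟩
    positivity
  have hder : ∀ r : ℝ, 0 < r → HasDerivAt (fun r : ℝ => (Φ (r * u)).re)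
      ((((r : ℂ) * u) ^ ((c : ℂ) - 1) / 2 * herglotz n (r * u) * u).re) r := by
    intro r hr
    have h1 : HasDerivAt (fun r : ℝ => (r : ℂ) * u) u r := by
      simpa using ((hasDerivAt_id r).ofReal_comp).mul_const u
    have h2 := (hΦ _ (hmem r hr)).scomp r h1
    have h3 := Complex.reCLM.hasFDerivAt.comp_hasDerivAt r h2
    refine h3.congr_deriv ?_
    rw [Complex.reCLM_apply, smul_eq_mul, mul_comm]
  have hcob : Tendsto (fun r : ℝ => (r : ℂ) * u) atTop (Bornology.cobounded ℂ) := by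
    rw [← tendsto_norm_atTop_iff_cobounded]
    have : (fun r : ℝ => ‖(r : ℂ) * u‖) = fun r => |r| := by
      funext r; rw [norm_mul, hu, Complex.norm_exp_ofReal_mul_I, mul_one, Complex.norm_real,
        Real.norm_eq_abs]
    rw [this]
    exact tendsto_abs_atTop_atTop
  have hq := (tendsto_herglotz_div hn).comp hcob
  have hq2 : Tendsto (fun r : ℝ => (Complex.exp (((c + 1) * θ : ℝ) * Complex.I) *
      (herglotz n (r * u) / (r * u))).re) atTop (𝓝 (Real.cos ((c + 1) * θ) / n)) := by
    have h := (Complex.continuous_re.tendsto _).comp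
      (hq.const_mul (Complex.exp (((c + 1) * θ : ℝ) * Complex.I)))
    have h2 : (Complex.exp (((c + 1) * θ : ℝ) * Complex.I) * (1 / (n : ℂ))).re =
        Real.cos ((c + 1) * θ) / n := by
      rw [show (1 / (n : ℂ)) = ((1 / n : ℝ) : ℂ) by push_cast; rfl, Complex.re_mul_ofReal,
        Complex.exp_ofReal_mul_I_re]
      ring
    rw [h2] at h
    exact h
  have hneg : Real.cos ((c + 1) * θ) / n < 0 := div_neg_of_neg_of_pos hcos hn'
  have hev := hq2.eventually_le_const (show Real.cos ((c + 1) * θ) / n <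
    Real.cos ((c + 1) * θ) / n / 2 by linarith)
  obtain ⟨r₀, hr₀⟩ := eventually_atTop.1 hev
  have key : Tendsto (fun r : ℝ => -(Φ (r * u)).re) atTop atTop := by
    refine tendsto_atTop_of_le_hasDerivAt (a := max r₀ 1)
      (δ := -(Real.cos ((c + 1) * θ) / n / 2) / 2) (by linarith)
      (fun r hr => (hder r (by
        have := (le_max_right r₀ 1).trans_lt (mem_Ioi.1 hr); linarith)).neg) fun r hr => ?_
    have hr1 : 1 < r := (le_max_right r₀ 1).trans_lt hr
    have hr0 : r₀ ≤ r := (le_max_left r₀ 1).trans (le_of_lt hr)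
    have hrpos : 0 < r := by linarith
    have hP0 := ne_zero_of_mem_rightHalf (hmem r hrpos)
    have hpow : ((r : ℂ) * u) ^ (c : ℂ) = ((r ^ c : ℝ) : ℂ) * Complex.exp ((c * θ : ℝ) * Complex.I) := by
      have hpi := Real.pi_pos
      obtain ⟨h1, h2⟩ := abs_lt.1 hθ
      have hlog : Complex.log ((r : ℂ) * u) = Real.log r + θ * Complex.I := by
        rw [Complex.log_ofReal_mul hrpos hu0, hu, Complex.log_exp] <;> simp <;> linarith
      rw [Complex.cpow_def_of_ne_zero hP0, hlog, Real.rpow_def_of_pos hrpos, Complex.ofReal_exp,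
        ← Complex.exp_add]
      congr 1
      push_cast
      ring
    -- The radial derivative is r^c/2 · e^(i(c+1)θ) · (kernel / P), and the last factor tends to
    -- 1/n; its real part is eventually below a negative constant.
    have heq : ((r : ℂ) * u) ^ ((c : ℂ) - 1) / 2 * herglotz n (r * u) * u =
        ((r ^ c / 2 : ℝ) : ℂ) * (Complex.exp (((c + 1) * θ : ℝ) * Complex.I) *
          (herglotz n (r * u) / (r * u))) := by
      rw [Complex.cpow_sub _ _ hP0, Complex.cpow_one, hpow]
      have : Complex.exp (((c + 1) * θ : ℝ) * Complex.I) =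
          Complex.exp ((c * θ : ℝ) * Complex.I) * u := by
        rw [hu, ← Complex.exp_add]; congr 1; push_cast; ring
      rw [this]
      push_cast
      field_simp
    rw [heq, Complex.re_ofReal_mul]
    have h1 : 1 ≤ r ^ c := Real.one_le_rpow hr1.le hc
    have h2 := hr₀ r hr0
    nlinarith
  have := tendsto_neg_atTop_atBot.comp key
  simpa [Function.comp_def] using this

theorem im_powK_ray (hc : 0 < c) {θ r : ℝ} (hθ : |θ| < π / 2) (hr : 0 < r) :
    (powK c (r * Complex.exp (θ * Complex.I))).im = r ^ c * Real.sin (c * θ) / (2 * c) := by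
  have hpi := Real.pi_pos
  obtain ⟨h1, h2⟩ := abs_lt.1 hθ
  have hu0 : Complex.exp (θ * Complex.I) ≠ 0 := Complex.exp_ne_zero _
  have hr0 : (r : ℂ) ≠ 0 := by exact_mod_cast hr.ne'
  have hlog : Complex.log ((r : ℂ) * Complex.exp (θ * Complex.I)) = Real.log r + θ * Complex.I := by
    rw [Complex.log_ofReal_mul hr hu0, Complex.log_exp] <;> simp <;> linarith
  have hpow : ((r : ℂ) * Complex.exp (θ * Complex.I)) ^ (c : ℂ) =
      ((r ^ c : ℝ) : ℂ) * Complex.exp ((c * θ : ℝ) * Complex.I) := by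
    rw [Complex.cpow_def_of_ne_zero (mul_ne_zero hr0 hu0), hlog, Real.rpow_def_of_pos hr,
      Complex.ofReal_exp, ← Complex.exp_add]
    congr 1
    push_cast
    ring
  simp only [powK, hc.ne', if_false]
  rw [hpow, show (1 / (2 * (c : ℂ))) = ((1 / (2 * c) : ℝ) : ℂ) by push_cast; rfl,
    Complex.im_ofReal_mul, Complex.sub_im, Complex.im_ofReal_mul, Complex.exp_ofReal_mul_I_im]
  simp
  field_simp

/-- The boundary function tends to `-∞` at infinity. -/
theorem IsShearSum.tendsto_boundaryFun_comp (hΦ : IsShearSum c n Φ)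
    (hc : c ∈ Ioo (0 : ℝ) 2) (hn : 1 ≤ n) {ε : ℝ} (hε : |ε| = 1)
    (hev : ∀ᶠ x in atTop, ¬ IsCrevice c n (sliceBdry c (ε * x))) :
    Tendsto (fun x => boundaryFun c Φ (ε * x)) atTop atBot := by
  have hpi := Real.pi_pos
  have hc0 := hc.1
  have hc2 := hc.2
  -- Chosen so that (c+1)θ = π(c+2)/4 lies in (π/2, π) while θ < π/2, for every c in (0, 2).
  set θ := π / 4 * ((c + 2) / (c + 1)) with hθ
  have hθ0 : 0 < θ := by positivity
  have hθ2 : θ < π / 2 := by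
    have : (c + 2) / (c + 1) < 2 := by rw [div_lt_iff₀ (by linarith)]; linarith
    rw [hθ]; nlinarith
  have hcθ : (c + 1) * θ = π / 4 * (c + 2) := by rw [hθ]; field_simp
  have habs : ∀ x : ℝ, |x * (ε * θ)| = |x| * θ := by
    intro x; rw [abs_mul, abs_mul, hε, one_mul, abs_of_pos hθ0]
  have hεθ : |ε * θ| < π / 2 := by have := habs 1; simp at this; rw [abs_mul]; simpa [hε, abs_of_pos hθ0]
  have hcos : Real.cos ((c + 1) * (ε * θ)) < 0 := by
    rw [← Real.cos_abs, habs, abs_of_pos (by linarith), hcθ]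
    apply Real.cos_neg_of_pi_div_two_lt_of_lt <;> nlinarith
  have hsin : 0 < Real.sin (c * θ) :=
    Real.sin_pos_of_pos_of_lt_pi (by positivity) (by nlinarith)
  have hsinε : Real.sin (c * (ε * θ)) = ε * Real.sin (c * θ) := by
    rcases (abs_eq zero_le_one).1 hε with rfl | rfl
    · simp
    · simp
  -- The radius at which the ray reaches height ±x, obtained by solving r^c sin(cθ)/(2c) = x.
  have hr : Tendsto (fun x : ℝ => (2 * c * x / Real.sin (c * θ)) ^ (1 / c)) atTop atTop := by
    refine (tendsto_rpow_atTop (by positivity)).comp ?_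
    have : (fun x : ℝ => 2 * c * x / Real.sin (c * θ)) = fun x => 2 * c / Real.sin (c * θ) * x := by
      funext x; ring
    rw [this]
    exact tendsto_id.const_mul_atTop (by positivity)
  have hlim := (hΦ.tendsto_ray hc0.le hn hεθ hcos).comp hr
  refine tendsto_atBot_mono' _ ?_ hlim
  filter_upwards [hev, eventually_gt_atTop 0] with x hx hx0
  set r := (2 * c * x / Real.sin (c * θ)) ^ (1 / c) with hrdef
  have hrpos : 0 < r := by positivity
  have him := im_powK_ray hc0 hεθ hrpos
  have hrc : r ^ c = 2 * c * x / Real.sin (c * θ) := by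
    rw [hrdef, ← Real.rpow_mul (by positivity), one_div, inv_mul_cancel₀ hc0.ne', Real.rpow_one]
  rw [hrc, hsinε] at him
  have him' : (powK c (r * Complex.exp ((ε * θ : ℝ) * Complex.I))).im = ε * x := by
    rw [him]; field_simp
  have hP : (r : ℂ) * Complex.exp ((ε * θ : ℝ) * Complex.I) ∈ rightHalf := by
    change 0 < ((r : ℂ) * _).re
    rw [Complex.re_ofReal_mul, Complex.exp_ofReal_mul_I_re]
    obtain ⟨h1, h2⟩ := abs_lt.1 hεθ
    have := Real.cos_pos_of_mem_Ioo ⟨by linarith, h2⟩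
    positivity
  have h1 := mem_sliceSet_powK (c := c) hP
  have h2 := sliceFun_powK (Φ := Φ) (Ioo_subset_Icc_self hc) hP
  rw [him'] at h1 h2
  have := hΦ.boundaryFun_lt hc hn hx h1
  rw [h2] at this
  exact this.le

end

/-! ### Poles of the kernel on the imaginary axis and the heights of the crevices. -/

theorem cayleyInv_cot {θ : ℝ} (h : Real.sin θ ≠ 0) :
    cayleyInv ⟨0, Real.cot θ⟩ = Complex.exp (2 * θ * Complex.I) := by
  have hs : (Real.sin θ : ℂ) ≠ 0 := by exact_mod_cast h
  have hb : (⟨0, Real.cot θ⟩ : ℂ) = Real.cos θ / Real.sin θ * Complex.I := by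
    rw [Complex.mk_eq_add_mul_I, Real.cot_eq_cos_div_sin]; push_cast; ring
  have he1 : Complex.exp (θ * Complex.I) = Real.cos θ + Real.sin θ * Complex.I := by
    rw [Complex.exp_mul_I]; push_cast; rfl
  have he2 : Complex.exp (-(θ * Complex.I)) = Real.cos θ - Real.sin θ * Complex.I := by
    rw [← neg_mul, Complex.exp_mul_I, Complex.cos_neg, Complex.sin_neg]; push_cast; ring
  have h1 : Complex.exp (2 * θ * Complex.I) =
      Complex.exp (θ * Complex.I) / Complex.exp (-(θ * Complex.I)) := by
    rw [← Complex.exp_sub]; congr 1; ring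
  have hne : Complex.exp (-(θ * Complex.I)) ≠ 0 := Complex.exp_ne_zero _
  rw [h1, cayleyInv, hb]
  have h2 : Real.cos θ / Real.sin θ * Complex.I - 1 =
      Complex.I * Complex.exp (θ * Complex.I) / Real.sin θ := by
    rw [he1]; field_simp; linear_combination (-(Real.sin θ : ℂ)) * Complex.I_sq
  have h3 : Real.cos θ / Real.sin θ * Complex.I + 1 =
      Complex.I * Complex.exp (-(θ * Complex.I)) / Real.sin θ := by
    rw [he2]; field_simp; linear_combination ((Real.sin θ : ℂ)) * Complex.I_sq
  rw [h2, h3]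
  have := Complex.I_ne_zero
  field_simp

/-- With y = cot θ and 0 < θ < π/2, the condition becomes e^(2inθ) = 1, that is nθ = kπ; the range
of θ gives 1 ≤ k < n/2. -/
theorem cayleyInv_pow_eq_one_iff {n : ℕ} (hn : 1 ≤ n) {y : ℝ} (hy : 0 < y) :
    cayleyInv ⟨0, y⟩ ^ n = 1 ↔ ∃ k : ℕ, 1 ≤ k ∧ 2 * k < n ∧ y = Real.cot (k * π / n) := by
  have hpi := Real.pi_pos
  have hn' : (0 : ℝ) < n := by exact_mod_cast hn
  constructor
  · intro h
    set θ := Real.arctan (1 / y) with hθ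
    have hθ0 : 0 < θ := Real.arctan_pos.2 (by positivity)
    have hθ2 : θ < π / 2 := Real.arctan_lt_pi_div_two _
    have hcot : Real.cot θ = y := by
      rw [← inv_inv (Real.cot θ), Real.cot_eq_cos_div_sin, inv_div, ← Real.tan_eq_sin_div_cos, hθ,
        Real.tan_arctan]
      simp
    have hs := Real.sin_pos_of_pos_of_lt_pi hθ0 (by linarith)
    rw [← hcot, cayleyInv_cot hs.ne', ← Complex.exp_nat_mul, Complex.exp_eq_one_iff] at h
    obtain ⟨k, hk⟩ := h
    have hk' : (n : ℝ) * θ = k * π := by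
      have := congrArg Complex.im hk
      simp at this
      linarith
    have hk0 : 0 < k := by
      have : (0 : ℝ) < k := by
        by_contra hcon
        push Not at hcon
        nlinarith [mul_pos hn' hθ0]
      exact_mod_cast this
    lift k to ℕ using hk0.le
    have hk'' : (n : ℝ) * θ = k * π := by simpa using hk'
    refine ⟨k, by exact_mod_cast hk0, ?_, ?_⟩
    · have : (2 * k : ℝ) < n := by
        have h1 : (2 * k : ℝ) * π < n * π := by nlinarith
        exact lt_of_mul_lt_mul_right h1 hpi.le
      exact_mod_cast this
    · rw [← hcot]
      congr 1
      field_simp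
      linarith
  · rintro ⟨k, hk, hkn, rfl⟩
    have hk' : (0 : ℝ) < k := by exact_mod_cast hk
    have hkn' : (2 * k : ℝ) < n := by exact_mod_cast hkn
    have hs : 0 < Real.sin (k * π / n) := by
      apply Real.sin_pos_of_pos_of_lt_pi (by positivity)
      rw [div_lt_iff₀ hn']
      nlinarith
    rw [cayleyInv_cot hs.ne', ← Complex.exp_nat_mul, Complex.exp_eq_one_iff]
    refine ⟨k, ?_⟩
    have : (n : ℂ) ≠ 0 := by exact_mod_cast hn'.ne'
    push_cast
    field_simp

theorem cayleyInv_pow_eq_one_iff_abs {n : ℕ} (hn : 1 ≤ n) {y : ℝ} (hy : y ≠ 0) :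
    cayleyInv ⟨0, y⟩ ^ n = 1 ↔ ∃ k : ℕ, 1 ≤ k ∧ 2 * k < n ∧ |y| = Real.cot (k * π / n) := by
  rw [← cayleyInv_pow_eq_one_iff hn (abs_pos.2 hy)]
  rcases lt_or_gt_of_ne hy with h | h
  · rw [abs_of_neg h]
    have h1 : cayleyInv ⟨0, -y⟩ = conj (cayleyInv ⟨0, y⟩) := by
      have : (⟨0, -y⟩ : ℂ) = conj (⟨0, y⟩ : ℂ) := by
        apply Complex.ext <;> simp
      rw [this, cayleyInv, cayleyInv]
      simp
    rw [h1, ← map_pow]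
    constructor
    · intro h; rw [h, map_one]
    · intro h
      have := congrArg conj h
      simpa using this
  · rw [abs_of_pos h]

theorem cot_pos_of_two_mul_lt {n k : ℕ} (hk : 1 ≤ k) (hkn : 2 * k < n) :
    0 < Real.cot (k * π / n) := by
  have hpi := Real.pi_pos
  have hk' : (0 : ℝ) < k := by exact_mod_cast hk
  have hkn' : (2 * k : ℝ) < n := by exact_mod_cast hkn
  have hn' : (0 : ℝ) < n := by linarith
  have h0 : 0 < k * π / n := by positivity
  have h2 : k * π / n < π / 2 := by rw [div_lt_div_iff₀ hn' two_pos]; nlinarith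
  rw [Real.cot_eq_cos_div_sin]
  exact div_pos (Real.cos_pos_of_mem_Ioo ⟨by linarith, h2⟩)
    (Real.sin_pos_of_pos_of_lt_pi h0 (by linarith))

/-- The cotangent heights are nonzero, so they never collide with the exceptional height 0, which
belongs to P = 0 alone. -/
theorem isCrevice_sliceBdry_iff {c : ℝ} (hc : c ∈ Ioo (0 : ℝ) 2) {n : ℕ} (hn : 1 ≤ n) (v : ℝ) :
    IsCrevice c n (sliceBdry c v) ↔ v ∈ waveHeights c n := by
  have hs := sin_angle_pos hc
  have hc0 := hc.1
  by_cases hv : v = 0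
  · subst hv
    rw [IsCrevice, if_pos (sliceBdry_zero hc)]
    constructor
    · rintro ⟨h1, h2⟩
      exact Or.inr ⟨h1, h2, rfl⟩
    · rintro (⟨k, hk, hkn, h⟩ | ⟨h1, h2, -⟩)
      · have := cot_pos_of_two_mul_lt hk hkn
        have h2 : 0 < Real.sin (c * π / 2) * Real.cot (k * π / n) ^ c / (2 * c) := by positivity
        rw [← h] at h2
        simp at h2
      · exact ⟨h1, h2⟩
  · have hb := sliceBdry_ne_zero hc hv
    have hre := re_sliceBdry hc v
    have hy : (sliceBdry c v).im ≠ 0 := fun h => hb (Complex.ext hre h)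
    have hbeq : sliceBdry c v = ⟨0, (sliceBdry c v).im⟩ := Complex.ext hre rfl
    have hpow := abs_im_sliceBdry_rpow hc hv
    rw [IsCrevice, if_neg hb, hbeq, cayleyInv_pow_eq_one_iff_abs hn hy]
    set y := (sliceBdry c v).im
    constructor
    · rintro ⟨k, hk, hkn, h⟩
      left
      exact ⟨k, hk, hkn, by rw [hpow, h]⟩
    · rintro (⟨k, hk, hkn, h⟩ | ⟨-, -, h⟩)
      · refine ⟨k, hk, hkn, ?_⟩
        have hcot := cot_pos_of_two_mul_lt hk hkn
        rw [h] at hpow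
        have hcancel : ∀ A B : ℝ, Real.sin (c * π / 2) * A / (2 * c) =
            Real.sin (c * π / 2) * B / (2 * c) → A = B := by
          intro A B h
          field_simp at h
          exact h
        have h3 := hcancel _ _ hpow
        exact ((Real.rpow_left_inj hcot.le (abs_nonneg y) hc0.ne').1 h3).symm
      · exact absurd h hv

theorem finite_waveHeights (c : ℝ) (n : ℕ) : (waveHeights c n).Finite := by
  set H : ℕ → ℝ := fun k => Real.sin (c * π / 2) * Real.cot (k * π / n) ^ c / (2 * c)
  have hfin : ((H '' (Set.Iio n)) ∪ ((fun x => -x) '' (H '' (Set.Iio n))) ∪ {0} : Set ℝ).Finite :=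
    (((Set.finite_Iio n).image H).union (((Set.finite_Iio n).image H).image _)).union
      (Set.finite_singleton 0)
  refine hfin.subset ?_
  rintro v (⟨k, hk, hkn, h⟩ | ⟨-, -, h⟩)
  · left
    have hk' : H k ∈ H '' Set.Iio n := mem_image_of_mem H (by simp only [mem_Iio]; omega)
    rcases abs_choice v with h' | h'
    · left
      rw [h'] at h
      rw [h]; exact hk'
    · right
      rw [h'] at h
      exact ⟨H k, hk', by simp only [H]; rw [← h, neg_neg]⟩
  · right; exact h

/-! ### Identification of the ranges: wave plane, strip, half-strip, slit domain. -/

section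
variable {c : ℝ} {n : ℕ} {Φ : ℂ → ℂ}

theorem eventually_notMem_of_finite {E : Set ℝ} (hE : E.Finite) :
    ∀ᶠ x in atTop, x ∉ E := by
  obtain ⟨M, hM⟩ := hE.bddAbove
  filter_upwards [eventually_gt_atTop M] with x hx h
  exact (hM h).not_gt hx

theorem eventually_neg_notMem_of_finite {E : Set ℝ} (hE : E.Finite) :
    ∀ᶠ x in atTop, -x ∉ E := by
  obtain ⟨M, hM⟩ := hE.bddBelow
  filter_upwards [eventually_gt_atTop (-M)] with x hx h
  linarith [hM h]

theorem IsShearSum.isWavePlane (hΦ : IsShearSum c n Φ) (hc : c ∈ Ioo (0 : ℝ) 2) (hn : 1 ≤ n) :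
    IsWavePlane (waveHeights c n) (shearMap c Φ '' rightHalf) := by
  have hE := finite_waveHeights c n
  have hiff := isCrevice_sliceBdry_iff hc hn
  refine ⟨hE, boundaryFun c Φ, ?_, ?_, ?_, ?_, ?_⟩
  · ext w
    rw [mem_shearMap_image (Ioo_subset_Icc_self hc)]
    by_cases h : IsCrevice c n (sliceBdry c w.im)
    · rw [hΦ.image_sliceFun_of_isCrevice hc hn h]
      exact ⟨fun _ => Or.inl ((hiff _).1 h), fun _ => mem_univ _⟩
    · rw [hΦ.image_sliceFun_of_not_isCrevice hc hn h]
      exact ⟨fun h' => Or.inr h', fun h' => h'.resolve_left (mt (hiff _).2 h)⟩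
  · refine (hΦ.continuousOn_boundaryFun hc hn).mono fun v hv => ?_
    exact mt (hiff v).1 hv
  · intro e he
    refine hΦ.tendsto_boundaryFun_of_isCrevice hc hn ((hiff e).2 he) ?_
    have hcl : IsClosed (waveHeights c n \ {e}) := (hE.subset sdiff_subset).isClosed
    have : ∀ᶠ v in 𝓝 e, v ∉ waveHeights c n \ {e} :=
      hcl.isOpen_compl.mem_nhds (by simp)
    filter_upwards [nhdsWithin_le_nhds this, self_mem_nhdsWithin] with v h1 h2
    exact fun h => h1 ⟨(hiff v).1 h, h2⟩
  · have := hΦ.tendsto_boundaryFun_comp hc hn (ε := 1) abs_one (by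
      filter_upwards [eventually_notMem_of_finite hE] with x hx
      rw [one_mul]; exact mt (hiff x).1 hx)
    simpa using this
  · have := hΦ.tendsto_boundaryFun_comp hc hn (ε := -1) (by simp) (by
      filter_upwards [eventually_neg_notMem_of_finite hE] with x hx
      rw [neg_one_mul]; exact mt (hiff (-x)).1 hx)
    have h2 := this.comp tendsto_neg_atBot_atTop
    simpa [Function.comp_def] using h2

theorem IsShearSum.image_eq_strip (hΦ : IsShearSum 0 n Φ) (hn : 1 ≤ n) (he : Even n) :
    shearMap 0 Φ '' rightHalf = strip := by
  have hc : (0 : ℝ) ∈ Icc (0 : ℝ) 2 := by simp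
  ext w
  rw [mem_shearMap_image hc]
  rcases lt_or_ge |w.im| (π / 4) with h | h
  · have h1 : sliceFun 0 Φ w.im '' sliceSet 0 w.im = univ := by
      refine image_eq_univ_of_tendsto (convex_sliceSet hc _).isPreconnected
        (hΦ.continuousOn_sliceFun hc _) (l₁ := atBot) (l₂ := atTop) ?_ ?_
        (hΦ.tendsto_sliceFun_zero_atBot hn he h) (hΦ.tendsto_sliceFun_atTop hc hn fun _ => h)
      · rw [sliceSet_zero h]; exact Eventually.of_forall fun x => mem_univ x
      · rw [sliceSet_zero h]; exact Eventually.of_forall fun x => mem_univ x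
    rw [h1]
    exact ⟨fun _ => h, fun _ => mem_univ _⟩
  · rw [sliceSet_zero_of_le h, image_empty]
    exact ⟨fun h' => h'.elim, fun h' => absurd h' h.not_gt⟩

/-- All slices run into the same point P = 0 as s → -∞, where the limit is finite; a common left end
`a` means a vertical side. -/
theorem IsShearSum.image_eq_halfStrip (hΦ : IsShearSum 0 n Φ) (hn : 1 ≤ n) (ho : Odd n) :
    ∃ a, shearMap 0 Φ '' rightHalf = halfStrip a := by
  have hc : (0 : ℝ) ∈ Icc (0 : ℝ) 2 := by simp
  obtain ⟨a, ha⟩ := hΦ.exists_tendsto_zero_of_odd le_rfl ho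
  refine ⟨a, ?_⟩
  ext w
  rw [mem_shearMap_image hc]
  rcases lt_or_ge |w.im| (π / 4) with h | h
  · have hset := sliceSet_zero h
    have hlim : Tendsto (sliceFun 0 Φ w.im) atBot (𝓝 a) := by
      refine ha.comp (tendsto_nhdsWithin_iff.2 ⟨?_, ?_⟩)
      · rw [tendsto_zero_iff_norm_tendsto_zero]
        have : (fun s : ℝ => ‖powJ 0 ⟨s, w.im⟩‖) = fun s => Real.exp (2 * s) := by
          funext s; rw [powJ_zero, Complex.norm_exp]
        rw [this]
        exact Real.tendsto_exp_atBot.comp (tendsto_id.const_mul_atBot two_pos)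
      · refine Eventually.of_forall fun s => powJ_mem hc ?_
        change s ∈ sliceSet 0 w.im
        rw [hset]; exact mem_univ s
    have h1 : sliceFun 0 Φ w.im '' sliceSet 0 w.im = Ioi a := by
      refine image_eq_Ioi_of_tendsto (convex_sliceSet hc _).isPreconnected
        (hΦ.continuousOn_sliceFun hc _) (l₁ := atBot) (l₂ := atTop) ?_ ?_
        hlim (hΦ.tendsto_sliceFun_atTop hc hn fun _ => h) fun s hs =>
          lt_of_strictMonoOn_of_tendsto (hΦ.strictMonoOn_sliceFun hc hn _) hlim ?_ hs
      · rw [hset]; exact Eventually.of_forall fun x => mem_univ x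
      · rw [hset]; exact Eventually.of_forall fun x => mem_univ x
      · intro s _
        rw [hset]
        refine ⟨s - 1, mem_univ _, by linarith, ?_⟩
        filter_upwards [eventually_le_atBot (s - 1)] with r hr
        exact ⟨mem_univ r, hr⟩
    rw [h1]
    exact ⟨fun h' => ⟨h, h'⟩, fun h' => h'.2⟩
  · rw [sliceSet_zero_of_le h, image_empty]
    exact ⟨fun h' => h'.elim, fun h' => absurd h'.1 h.not_gt⟩

/-- Only the slice at height 0 ends at P = 0, where the limit is finite because 2 > 1; every other
slice fills its line. -/
theorem IsShearSum.image_eq_slitDomain (hΦ : IsShearSum 2 n Φ) (hn : 1 ≤ n) :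
    ∃ a, shearMap 2 Φ '' rightHalf = slitDomain a := by
  have hc : (2 : ℝ) ∈ Icc (0 : ℝ) 2 := by simp
  obtain ⟨a, ha⟩ := hΦ.exists_tendsto_zero_of_one_lt one_lt_two hn
  refine ⟨a, ?_⟩
  ext w
  rw [mem_shearMap_image hc]
  have htop := hΦ.tendsto_sliceFun_atTop hc hn (v := w.im) (fun h => absurd h two_ne_zero)
  by_cases hw : w.im = 0
  · rw [hw] at htop ⊢
    have hset := sliceSet_two_zero
    have hlim : Tendsto (sliceFun 2 Φ 0) (𝓝[>] (-(1 / 4))) (𝓝 a) := by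
      refine ha.comp (tendsto_nhdsWithin_iff.2 ⟨?_, ?_⟩)
      · have h1 : ∀ᶠ s : ℝ in 𝓝[>] (-(1 / 4)), ((Real.sqrt (1 + 4 * s) : ℝ) : ℂ) = powJ 2 ⟨s, 0⟩ := by
          filter_upwards [self_mem_nhdsWithin] with s hs
          have hs' : -(1 / 4) < s := hs
          simp only [powJ, if_neg (two_ne_zero (α := ℝ))]
          have : (1 + 2 * ((2 : ℝ) : ℂ) * ⟨s, 0⟩) = ((1 + 4 * s : ℝ) : ℂ) := by
            apply Complex.ext <;> norm_num
          rw [this, Real.sqrt_eq_rpow, Complex.ofReal_cpow (by linarith)]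
          push_cast; rfl
        have h2 : ContinuousAt (fun s : ℝ => ((Real.sqrt (1 + 4 * s) : ℝ) : ℂ)) (-(1 / 4)) := by
          fun_prop
        have h3 := (h2.tendsto.mono_left (nhdsWithin_le_nhds (s := Ioi (-(1 / 4))))).congr' h1
        have h4 : (1 + 4 * -(1 / 4) : ℝ) = 0 := by norm_num
        simpa only [h4, Real.sqrt_zero, Complex.ofReal_zero] using h3
      · filter_upwards [self_mem_nhdsWithin] with s hs
        refine powJ_mem hc ?_
        change s ∈ sliceSet 2 0
        rw [hset]; exact hs
    have h1 : sliceFun 2 Φ 0 '' sliceSet 2 0 = Ioi a := by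
      refine image_eq_Ioi_of_tendsto (convex_sliceSet hc _).isPreconnected
        (hΦ.continuousOn_sliceFun hc _) (l₁ := 𝓝[>] (-(1 / 4))) (l₂ := atTop) ?_ ?_
        hlim htop fun s hs =>
          lt_of_strictMonoOn_of_tendsto (hΦ.strictMonoOn_sliceFun hc hn _) hlim ?_ hs
      · rw [hset]; exact self_mem_nhdsWithin
      · rw [hset]; exact Ioi_mem_atTop _
      · intro s hs
        rw [hset] at hs ⊢
        have hs' : -(1 / 4) < s := hs
        refine ⟨(-(1 / 4) + s) / 2, by simp only [mem_Ioi]; linarith, by linarith, ?_⟩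
        filter_upwards [Ioo_mem_nhdsGT (show -(1 / 4) < (-(1 / 4) + s) / 2 by linarith)]
          with r hr
        exact ⟨hr.1, hr.2.le⟩
    rw [h1, slitDomain]
    simp [hw]
  · have h1 : sliceFun 2 Φ w.im '' sliceSet 2 w.im = univ := by
      refine image_eq_univ_of_tendsto (convex_sliceSet hc _).isPreconnected
        (hΦ.continuousOn_sliceFun hc _) (l₁ := atBot) (l₂ := atTop) ?_ ?_
        (hΦ.tendsto_sliceFun_two_atBot hn hw) htop
      · rw [sliceSet_two hw]; exact Eventually.of_forall fun x => mem_univ x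
      · rw [sliceSet_two hw]; exact Eventually.of_forall fun x => mem_univ x
    rw [h1, slitDomain]
    simp [hw]

end

/-! ### Shears in the disk: existence, continuity in c, membership in S_H^0. -/

/-- The derivative of the generalized Koebe function. -/
def koebeDeriv (c : ℝ) (z : ℂ) : ℂ := cayley z ^ ((c : ℂ) - 1) / (1 - z) ^ 2

theorem hasDerivAt_koebe (c : ℝ) {z : ℂ} (hz : z ∈ disk) :
    HasDerivAt (koebe c) (koebeDeriv c z) z := by
  refine ((hasDerivAt_powK c (cayley_mem_rightHalf hz)).comp z
    (hasDerivAt_cayley (one_sub_ne_zero_of_mem_disk hz))).congr_deriv ?_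
  rw [koebeDeriv]
  ring

theorem koebeDeriv_ne_zero (c : ℝ) {z : ℂ} (hz : z ∈ disk) : koebeDeriv c z ≠ 0 := by
  have h1 := one_sub_ne_zero_of_mem_disk hz
  have h2 := ne_zero_of_mem_rightHalf (cayley_mem_rightHalf hz)
  have h3 : cayley z ^ ((c : ℂ) - 1) ≠ 0 := by simp [Complex.cpow_eq_zero_iff, h2]
  rw [koebeDeriv]
  positivity

theorem koebe_zero (c : ℝ) : koebe c 0 = 0 := by
  simp [koebe]

theorem zero_mem_disk : (0 : ℂ) ∈ disk := by simp [mem_disk]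

/-- Holomorphic functions on the disk have primitives. -/
theorem exists_primitive {f : ℂ → ℂ} (hf : DifferentiableOn ℂ f disk) :
    ∃ F : ℂ → ℂ, F 0 = 0 ∧ ∀ z ∈ disk, HasDerivAt F (f z) z := by
  obtain ⟨F, hF⟩ := hf.isExactOn_ball
  exact ⟨fun z => F z - F 0, sub_self _, fun z hz => (hF z hz).sub_const _⟩

/-- The derivative of the analytic part of the shear. -/
def shearDeriv (c : ℝ) (n : ℕ) (z : ℂ) : ℂ := koebeDeriv c z / (1 - z ^ n)

theorem continuousOn_shearDeriv {n : ℕ} (hn : 1 ≤ n) :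
    ContinuousOn (fun p : ℝ × ℂ => shearDeriv p.1 n p.2) (univ ×ˢ disk) := by
  rintro ⟨c, z⟩ ⟨-, hz⟩
  have h1 := one_sub_ne_zero_of_mem_disk hz
  have h2 := one_sub_ne_zero_of_mem_disk (pow_mem_disk hn hz)
  have h3 := rightHalf_subset_slitPlane (cayley_mem_rightHalf hz)
  refine ContinuousAt.continuousWithinAt ?_
  unfold shearDeriv koebeDeriv
  have hc : ContinuousAt (fun p : ℝ × ℂ => cayley p.2) (c, z) :=
    (hasDerivAt_cayley h1).continuousAt.comp (f := fun p : ℝ × ℂ => p.2) continuousAt_snd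
  refine ContinuousAt.div (ContinuousAt.div (hc.cpow (by fun_prop) h3) (by fun_prop) ?_)
    (by fun_prop) h2
  exact pow_ne_zero 2 h1

theorem differentiableOn_shearDeriv {n : ℕ} (hn : 1 ≤ n) (c : ℝ) :
    DifferentiableOn ℂ (shearDeriv c n) disk := by
  intro z hz
  have h1 := one_sub_ne_zero_of_mem_disk hz
  have h2 := one_sub_ne_zero_of_mem_disk (pow_mem_disk hn hz)
  have h3 := rightHalf_subset_slitPlane (cayley_mem_rightHalf hz)
  refine DifferentiableAt.differentiableWithinAt ?_
  unfold shearDeriv koebeDeriv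
  have hc := (hasDerivAt_cayley h1).differentiableAt
  refine DifferentiableAt.div (DifferentiableAt.div (hc.cpow (by fun_prop) h3) (by fun_prop) ?_)
    (by fun_prop) h2
  exact pow_ne_zero 2 h1

/-- The conditions h' - g' = k_c' and g' = z^n h' force h' = k_c'/(1 - z^n); a primitive of this and
g = h - k_c solve them. -/
theorem exists_isShear {n : ℕ} (hn : 1 ≤ n) (c : ℝ) :
    ∃ h g : ℂ → ℂ, IsShear (koebe c) (fun z => z ^ n) h g := by
  obtain ⟨h, h0, hd⟩ := exists_primitive (differentiableOn_shearDeriv hn c)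
  have hg : ∀ z ∈ disk, HasDerivAt (fun z => h z - koebe c z)
      (shearDeriv c n z - koebeDeriv c z) z := fun z hz => (hd z hz).sub (hasDerivAt_koebe c hz)
  refine ⟨h, fun z => h z - koebe c z, ⟨fun z hz => (hd z hz).differentiableAt.differentiableWithinAt,
    fun z hz => (hg z hz).differentiableAt.differentiableWithinAt, h0, ?_, ?_, ?_⟩⟩
  · simp only [h0, koebe_zero, sub_self]
  · intro z _; ring
  · intro z hz
    rw [(hg z hz).deriv, (hd z hz).deriv, shearDeriv]
    have h2 := one_sub_ne_zero_of_mem_disk (pow_mem_disk hn hz)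
    field_simp
    ring

/-- A family of functions that vanish at `0` depends continuously on the parameter if the
derivatives do. -/
theorem continuousOn_of_continuousOn_deriv {S : Set ℝ} {h h' : ℝ → ℂ → ℂ}
    (h0 : ∀ c ∈ S, h c 0 = 0) (hd : ∀ c ∈ S, ∀ z ∈ disk, HasDerivAt (h c) (h' c z) z)
    (hcont : ContinuousOn (fun p : ℝ × ℂ => h' p.1 p.2) (S ×ˢ disk)) :
    ContinuousOn (fun p : ℝ × ℂ => h p.1 p.2) (S ×ˢ disk) := by
  have hmem : ∀ (t : ℝ) (z : ℂ), z ∈ disk → t ∈ Icc (0 : ℝ) 1 → (t : ℂ) * z ∈ disk := by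
    intro t z hz ht
    rw [mem_disk] at *
    rw [norm_mul, Complex.norm_real, Real.norm_eq_abs, abs_of_nonneg ht.1]
    nlinarith [norm_nonneg z, ht.2]
  -- Integrand of h(c, z) = ∫₀¹ z h'(c, tz) dt. Clamping t with `projIcc` makes it continuous for
  -- all real t without changing the integral.
  set F : ↥(S ×ˢ disk) → ℝ → ℂ := fun x t =>
    x.1.2 * h' x.1.1 (((projIcc (0 : ℝ) 1 zero_le_one t : ℝ) : ℂ) * x.1.2) with hF
  have hFc : Continuous (Function.uncurry F) := by
    have harg : Continuous fun q : ↥(S ×ˢ disk) × ℝ =>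
        ((q.1.1.1, ((projIcc (0 : ℝ) 1 zero_le_one q.2 : ℝ) : ℂ) * q.1.1.2) : ℝ × ℂ) := by
      have h1 : Continuous fun q : ↥(S ×ˢ disk) × ℝ => (projIcc (0 : ℝ) 1 zero_le_one q.2 : ℝ) :=
        continuous_subtype_val.comp (continuous_projIcc.comp continuous_snd)
      fun_prop
    have h2 := hcont.comp_continuous harg fun q =>
      ⟨q.1.2.1, hmem _ _ q.1.2.2 (projIcc (0 : ℝ) 1 zero_le_one q.2).2⟩
    exact (by fun_prop : Continuous fun q : ↥(S ×ˢ disk) × ℝ => q.1.1.2).mul h2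
  have hint := intervalIntegral.continuous_parametric_intervalIntegral_of_continuous'
    (μ := MeasureTheory.volume) hFc 0 1
  rw [continuousOn_iff_continuous_domRestrict]
  convert hint using 1
  funext x
  obtain ⟨⟨c, z⟩, hc, hz⟩ := x
  simp only at hc hz
  have hder : ∀ t ∈ uIcc (0 : ℝ) 1, HasDerivAt (fun t : ℝ => h c (t * z)) (F ⟨(c, z), hc, hz⟩ t) t := by
    intro t ht
    rw [uIcc_of_le zero_le_one] at ht
    have h1 : HasDerivAt (fun t : ℝ => (t : ℂ) * z) z t := by
      simpa using ((hasDerivAt_id t).ofReal_comp).mul_const z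
    have h2 := (hd c hc _ (hmem t z hz ht)).scomp t h1
    refine h2.congr_deriv ?_
    simp only [hF, projIcc_of_mem zero_le_one ht, smul_eq_mul]
  have hFt : Continuous (F ⟨(c, z), hc, hz⟩) :=
    hFc.comp (Continuous.prodMk_right (⟨(c, z), hc, hz⟩ : ↥(S ×ˢ disk)))
  rw [intervalIntegral.integral_eq_sub_of_hasDerivAt hder (hFt.intervalIntegrable 0 1)]
  simp [h0 c hc]

section
variable {c : ℝ} {n : ℕ} {h g : ℂ → ℂ}

theorem DifferentiableOn.hasDerivAt_disk {f : ℂ → ℂ} (hf : DifferentiableOn ℂ f disk) {z : ℂ}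
    (hz : z ∈ disk) : HasDerivAt f (_root_.deriv f z) z :=
  (hf.differentiableAt (isOpen_disk.mem_nhds hz)).hasDerivAt

theorem IsShear.deriv_h (H : IsShear (koebe c) (fun z => z ^ n) h g) (hn : 1 ≤ n) {z : ℂ}
    (hz : z ∈ disk) : deriv h z = shearDeriv c n z := by
  have h1 := H.analytic_h.hasDerivAt_disk hz
  have h2 := H.analytic_g.hasDerivAt_disk hz
  have h3 : deriv h z - deriv g z = koebeDeriv c z := by
    refine (h1.sub h2).unique ((hasDerivAt_koebe c hz).congr_of_eventuallyEq ?_)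
    filter_upwards [isOpen_disk.mem_nhds hz] with x hx
    exact H.sub_eq x hx
  have h4 := H.dilatation z hz
  have h5 := one_sub_ne_zero_of_mem_disk (pow_mem_disk hn hz)
  rw [shearDeriv, eq_div_iff h5, ← h3, h4]
  ring

theorem IsShear.deriv_g (H : IsShear (koebe c) (fun z => z ^ n) h g) (hn : 1 ≤ n) {z : ℂ}
    (hz : z ∈ disk) : deriv g z = z ^ n * shearDeriv c n z := by
  rw [H.dilatation z hz, H.deriv_h hn hz]

theorem shearDeriv_ne_zero (hn : 1 ≤ n) {z : ℂ} (hz : z ∈ disk) : shearDeriv c n z ≠ 0 :=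
  div_ne_zero (koebeDeriv_ne_zero c hz) (one_sub_ne_zero_of_mem_disk (pow_mem_disk hn hz))

/-- The kernel appears because (h' + g')/(h' - g') = (1 + z^n)/(1 - z^n). -/
theorem IsShear.isShearSum (H : IsShear (koebe c) (fun z => z ^ n) h g) (hn : 1 ≤ n) :
    IsShearSum c n (fun P => h (cayleyInv P) + g (cayleyInv P)) := by
  intro P hP
  have hz := cayleyInv_mem_disk hP
  have hP1 := add_one_ne_zero_of_re_nonneg (le_of_lt hP)
  have hN := hasDerivAt_cayleyInv hP1
  refine (((H.analytic_h.hasDerivAt_disk hz).comp P hN).add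
    ((H.analytic_g.hasDerivAt_disk hz).comp P hN)).congr_deriv ?_
  rw [H.deriv_h hn hz, H.deriv_g hn hz, shearDeriv, koebeDeriv, cayley_cayleyInv hP1, herglotz]
  have h5 := one_sub_ne_zero_of_mem_disk (pow_mem_disk hn hz)
  rw [cayley]
  have h6 : 1 - cayleyInv P = 2 / (P + 1) := by rw [cayleyInv]; field_simp; ring
  rw [h6]
  field_simp

theorem IsShear.harmonicMap_eq (H : IsShear (koebe c) (fun z => z ^ n) h g) {z : ℂ}
    (hz : z ∈ disk) : harmonicMap h g z =
      shearMap c (fun P => h (cayleyInv P) + g (cayleyInv P)) (cayley z) := by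
  have h1 := H.sub_eq z hz
  apply Complex.ext
  · simp [harmonicMap, shearMap, cayleyInv_cayley hz]
  · simp only [shearMap]
    rw [← koebe_eq_powK, ← h1]
    simp [harmonicMap, sub_eq_add_neg]

theorem IsShear.image_eq (H : IsShear (koebe c) (fun z => z ^ n) h g) :
    harmonicMap h g '' disk =
      shearMap c (fun P => h (cayleyInv P) + g (cayleyInv P)) '' rightHalf := by
  rw [← cayley_image_disk, image_image]
  exact image_congr fun z hz => H.harmonicMap_eq hz

theorem IsShear.norm_deriv_lt (H : IsShear (koebe c) (fun z => z ^ n) h g) (hn : 1 ≤ n) {z : ℂ}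
    (hz : z ∈ disk) : ‖deriv g z‖ < ‖deriv h z‖ := by
  rw [H.dilatation z hz, norm_mul]
  have h1 : 0 < ‖deriv h z‖ := by
    rw [H.deriv_h hn hz]; exact norm_pos_iff.2 (shearDeriv_ne_zero hn hz)
  have h2 := mem_disk.1 (pow_mem_disk hn hz)
  nlinarith

theorem IsShear.isSH0 (H : IsShear (koebe c) (fun z => z ^ n) h g) (hn : 1 ≤ n)
    (hc : c ∈ Icc (0 : ℝ) 2) : IsSH0 h g where
  analytic_h := H.analytic_h
  analytic_g := H.analytic_g
  h_zero := H.h_zero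
  g_zero := H.g_zero
  deriv_h_zero := by
    rw [H.deriv_h hn zero_mem_disk, shearDeriv, koebeDeriv, cayley]
    simp [show n ≠ 0 by omega]
  deriv_g_zero := by
    rw [H.deriv_g hn zero_mem_disk]
    simp [show n ≠ 0 by omega]
  jacobian_pos z hz := by
    have := H.norm_deriv_lt hn hz
    have := norm_nonneg (deriv g z)
    nlinarith
  univalent z hz w hw hzw := by
    rw [H.harmonicMap_eq hz, H.harmonicMap_eq hw] at hzw
    have := (H.isShearSum hn).injOn_shearMap hc hn (cayley_mem_rightHalf hz)
      (cayley_mem_rightHalf hw) hzw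
    rw [← cayleyInv_cayley hz, ← cayleyInv_cayley hw, this]

end

/-! ### Smoothness and local invertibility of harmonic mappings; horizontal convexity and continuity
in c. -/

section
variable {h g : ℂ → ℂ}

theorem DifferentiableOn.contDiffAt_disk {f : ℂ → ℂ} (hf : DifferentiableOn ℂ f disk) {z : ℂ}
    (hz : z ∈ disk) : ContDiffAt ℝ ∞ f z :=
  (hf.analyticAt (isOpen_disk.mem_nhds hz)).contDiffAt.restrict_scalars ℝ

theorem contDiffAt_harmonicMap (hh : DifferentiableOn ℂ h disk) (hg : DifferentiableOn ℂ g disk)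
    {z : ℂ} (hz : z ∈ disk) : ContDiffAt ℝ ∞ (harmonicMap h g) z :=
  (hh.contDiffAt_disk hz).add
    (Complex.conjCLE.contDiff.contDiffAt.comp z (hg.contDiffAt_disk hz))

/-- A harmonic mapping with positive Jacobian is locally invertible. -/
theorem exists_hasFDerivAt_harmonicMap (hh : DifferentiableOn ℂ h disk)
    (hg : DifferentiableOn ℂ g disk) {z : ℂ} (hz : z ∈ disk) (hlt : ‖deriv g z‖ < ‖deriv h z‖) :
    ∃ e : ℂ ≃L[ℝ] ℂ, HasFDerivAt (harmonicMap h g) (e : ℂ →L[ℝ] ℂ) z ∧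
      ∀ v, e v = deriv h z * v + conj (deriv g z * v) := by
  have h1 := (hh.hasDerivAt_disk hz).hasFDerivAt.restrictScalars ℝ
  have h2 := (hg.hasDerivAt_disk hz).hasFDerivAt.restrictScalars ℝ
  have h3 := h1.add (Complex.conjCLE.hasFDerivAt.comp z h2)
  set L := ContinuousLinearMap.restrictScalars ℝ (ContinuousLinearMap.toSpanSingleton ℂ (deriv h z))
    + (Complex.conjCLE : ℂ →L[ℝ] ℂ).comp (ContinuousLinearMap.restrictScalars ℝ
      (ContinuousLinearMap.toSpanSingleton ℂ (deriv g z))) with hL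
  have hLv : ∀ v, L v = deriv h z * v + conj (deriv g z * v) := by
    intro v
    simp [hL, mul_comm]
  have hinj : Function.Injective (L : ℂ →ₗ[ℝ] ℂ) := by
    rw [injective_iff_map_eq_zero]
    intro v hv
    have hv' : L v = 0 := hv
    rw [hLv] at hv'
    by_contra hv0
    have := congrArg norm (eq_neg_of_add_eq_zero_left hv')
    rw [norm_neg, RCLike.norm_conj, norm_mul, norm_mul] at this
    have := mul_right_cancel₀ (norm_ne_zero_iff.2 hv0) this
    exact hlt.ne' this
  refine ⟨(LinearEquiv.ofInjectiveEndo (L : ℂ →ₗ[ℝ] ℂ) hinj).toContinuousLinearEquiv, ?_, ?_⟩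
  · exact h3
  · exact hLv

theorem isOpen_image_harmonicMap (hh : DifferentiableOn ℂ h disk)
    (hg : DifferentiableOn ℂ g disk) (hlt : ∀ z ∈ disk, ‖deriv g z‖ < ‖deriv h z‖) :
    IsOpen (harmonicMap h g '' disk) := by
  rw [isOpen_iff_mem_nhds]
  rintro _ ⟨z, hz, rfl⟩
  obtain ⟨e, he, -⟩ := exists_hasFDerivAt_harmonicMap hh hg hz (hlt z hz)
  have hs := (contDiffAt_harmonicMap hh hg hz).hasStrictFDerivAt' he (by simp)
  rw [← hs.map_nhds_eq_of_equiv]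
  exact image_mem_map (isOpen_disk.mem_nhds hz)

end

section
variable {c : ℝ} {n : ℕ} {h g : ℂ → ℂ}

theorem IsShear.isCHD (H : IsShear (koebe c) (fun z => z ^ n) h g) (hn : 1 ≤ n)
    (hc : c ∈ Icc (0 : ℝ) 2) : IsCHD (harmonicMap h g '' disk) where
  isOpen := isOpen_image_harmonicMap H.analytic_h H.analytic_g fun _ hz => H.norm_deriv_lt hn hz
  isConnected := by
    refine ⟨⟨_, mem_image_of_mem _ zero_mem_disk⟩, ?_⟩
    exact (convex_ball (0 : ℂ) 1).isPreconnected.image _ fun z hz =>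
      (contDiffAt_harmonicMap H.analytic_h H.analytic_g hz).continuousAt.continuousWithinAt
  line y := by
    rw [H.image_eq]
    exact (H.isShearSum hn).isPreconnected_line hc y

end

theorem continuousOn_harmonicMap {n : ℕ} (hn : 1 ≤ n) {S : Set ℝ} {h g : ℝ → ℂ → ℂ}
    (H : ∀ c ∈ S, IsShear (koebe c) (fun z => z ^ n) (h c) (g c)) :
    ContinuousOn (fun p : ℝ × ℂ => harmonicMap (h p.1) (g p.1) p.2) (S ×ˢ disk) := by
  have hc : ContinuousOn (fun p : ℝ × ℂ => shearDeriv p.1 n p.2) (S ×ˢ disk) :=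
    (continuousOn_shearDeriv hn).mono (prod_mono (subset_univ S) Subset.rfl)
  have h1 := continuousOn_of_continuousOn_deriv (h := h) (h' := fun c z => shearDeriv c n z)
    (fun c hc => (H c hc).h_zero) (fun c hc z hz => by
      rw [← (H c hc).deriv_h hn hz]
      exact (H c hc).analytic_h.hasDerivAt_disk hz) hc
  have h2 := continuousOn_of_continuousOn_deriv (h := g)
    (h' := fun c z => z ^ n * shearDeriv c n z)
    (fun c hc => (H c hc).g_zero) (fun c hc z hz => by
      rw [← (H c hc).deriv_g hn hz]
      exact (H c hc).analytic_g.hasDerivAt_disk hz)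
    (((continuous_snd.pow n).continuousOn).mul hc)
  exact h1.add (Complex.continuous_conj.comp_continuousOn h2)

/-! ### The minimal surface equation and the lift. -/

theorem fderiv_apply_eq_partial (F : ℂ → ℝ) (w ξ : ℂ) :
    fderiv ℝ F w ξ = ξ.re * partialX F w + ξ.im * partialY F w := by
  have : ξ = ξ.re • (1 : ℂ) + ξ.im • Complex.I := by
    simp [Complex.re_add_im]
  conv_lhs => rw [this]
  rw [map_add, map_smul, map_smul]
  rfl

theorem contDiffAt_partial {F : ℂ → ℝ} {w : ℂ} (hF : ContDiffAt ℝ ∞ F w) (v : ℂ) :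
    ContDiffAt ℝ ∞ (fun w => fderiv ℝ F w v) w :=
  (hF.fderiv_right (m := ∞) (by norm_num)).clm_apply contDiffAt_const

theorem partialY_partialX {F : ℂ → ℝ} {w : ℂ} (hF : ContDiffAt ℝ ∞ F w) :
    partialY (partialX F) w = partialX (partialY F) w := by
  have hd : DifferentiableAt ℝ (fderiv ℝ F) w :=
    (hF.fderiv_right (m := ∞) (by norm_num)).differentiableAt (by simp)
  have h : ∀ u v : ℂ, fderiv ℝ (fun w => fderiv ℝ F w u) w v = fderiv ℝ (fderiv ℝ F) w v u := by
    intro u v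
    rw [fderiv_clm_apply hd (differentiableAt_const u)]
    simp
  have hs : IsSymmSndFDerivAt ℝ F w := hF.isSymmSndFDerivAt (by
    rw [minSmoothness_of_isRCLikeNormedField]; exact WithTop.coe_le_coe.2 le_top)
  change fderiv ℝ (fun w => fderiv ℝ F w 1) w Complex.I =
    fderiv ℝ (fun w => fderiv ℝ F w Complex.I) w 1
  rw [h, h]
  exact hs _ _

/-- The minimal surface equation from the Weierstrass data: `m` is the (stereographically
projected) Gauss map. -/
theorem minimal_equation_of_gauss {p q P M Q : ℝ} {m k : ℂ} (hG : ‖m‖ < 1) (hk : k ≠ 0)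
    (h₁ : (p : ℂ) * ((1 + m ^ 2) * k) + q * (-Complex.I * ((1 - m ^ 2) * k)) =
      -2 * Complex.I * (m * k))
    (h₂ : (P * conj ((1 + m ^ 2) * k) + M * conj (-Complex.I * ((1 - m ^ 2) * k))) *
        ((1 + m ^ 2) * k) +
      (M * conj ((1 + m ^ 2) * k) + Q * conj (-Complex.I * ((1 - m ^ 2) * k))) *
        (-Complex.I * ((1 - m ^ 2) * k)) = 0) :
    (1 + q ^ 2) * P - 2 * p * q * M + (1 + p ^ 2) * Q = 0 := by
  have hk2 : conj k ≠ 0 := (map_ne_zero _).2 hk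
  have h1 : (p : ℂ) * (1 + m ^ 2) + q * (-Complex.I * (1 - m ^ 2)) = -2 * Complex.I * m := by
    apply mul_right_cancel₀ hk
    linear_combination h₁
  have h2 : (P * (1 + conj m ^ 2) + M * (Complex.I * (1 - conj m ^ 2))) * (1 + m ^ 2) +
      (M * (1 + conj m ^ 2) + Q * (Complex.I * (1 - conj m ^ 2))) *
        (-Complex.I * (1 - m ^ 2)) = 0 := by
    apply mul_right_cancel₀ (mul_ne_zero hk hk2)
    simp only [map_mul, map_add, map_sub, map_pow, map_one, map_neg, Complex.conj_I] at h₂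
    linear_combination h₂
  obtain ⟨a, b⟩ := m
  have hr : a ^ 2 + b ^ 2 < 1 := by
    have h3 := Complex.sq_norm (⟨a, b⟩ : ℂ)
    rw [Complex.normSq_mk] at h3
    nlinarith [norm_nonneg (⟨a, b⟩ : ℂ)]
  have e1 := congrArg Complex.re h1
  have e2 := congrArg Complex.im h1
  have e3 := congrArg Complex.re h2
  simp [pow_two] at e1 e2 e3
  set D := 1 - (a ^ 2 + b ^ 2) with hD
  have hD0 : 0 < D := by linarith
  have hD1 : 0 < 1 + (a ^ 2 + b ^ 2) := by positivity
  -- The first identity determines the gradient: (p, q) = (2b, 2a)/(1 - |m|²). Substituted into the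
  -- target times D², it leaves exactly the real part of the second identity.
  have hp : p * D = 2 * b := by
    apply mul_right_cancel₀ hD1.ne'
    linear_combination (1 - (a * a - b * b)) * e1 - 2 * a * b * e2
  have hq : q * D = 2 * a := by
    apply mul_right_cancel₀ hD1.ne'
    linear_combination 2 * a * b * e1 - (1 + (a * a - b * b)) * e2
  have hD2 : D ^ 2 ≠ 0 := by positivity
  apply mul_right_cancel₀ hD2
  have e4 : ((1 + q ^ 2) * P - 2 * p * q * M + (1 + p ^ 2) * Q) * D ^ 2 =
      (D ^ 2 + (q * D) ^ 2) * P - 2 * (p * D) * (q * D) * M + (D ^ 2 + (p * D) ^ 2) * Q := by ring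
  rw [e4, hp, hq]
  linear_combination e3

section
variable {h g : ℂ → ℂ}

/-- The inverse of a univalent harmonic mapping is smooth. -/
theorem contDiffAt_invFunOn_harmonicMap (hh : DifferentiableOn ℂ h disk)
    (hg : DifferentiableOn ℂ g disk) (hinj : InjOn (harmonicMap h g) disk) {z : ℂ} (hz : z ∈ disk)
    (hlt : ‖deriv g z‖ < ‖deriv h z‖) :
    ContDiffAt ℝ ∞ (Function.invFunOn (harmonicMap h g) disk) (harmonicMap h g z) := by
  obtain ⟨e, he, -⟩ := exists_hasFDerivAt_harmonicMap hh hg hz hlt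
  have hf := contDiffAt_harmonicMap hh hg hz
  have hs := hf.hasStrictFDerivAt' he (by simp)
  have hloc : ContDiffAt ℝ ∞ (hs.localInverse (harmonicMap h g) e z) (harmonicMap h g z) :=
    hf.to_localInverse he (by simp)
  refine hloc.congr_of_eventuallyEq ?_
  have hmem : ∀ᶠ y in 𝓝 (harmonicMap h g z), hs.localInverse (harmonicMap h g) e z y ∈ disk := by
    refine hloc.continuousAt.eventually_mem ?_
    rw [hs.localInverse_apply_image]
    exact isOpen_disk.mem_nhds hz
  filter_upwards [hs.eventually_right_inverse, hmem] with y hy hyd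
  have hex : y ∈ harmonicMap h g '' disk := ⟨_, hyd, hy⟩
  exact hinj (Function.invFunOn_mem hex) hyd ((Function.invFunOn_eq hex).trans hy.symm)

variable {T G : ℂ → ℂ} {F : ℂ → ℝ}

theorem fderiv_harmonicMap_apply (hh : DifferentiableOn ℂ h disk)
    (hg : DifferentiableOn ℂ g disk) {z : ℂ} (hz : z ∈ disk)
    (hlt : ‖deriv g z‖ < ‖deriv h z‖) (v : ℂ) :
    fderiv ℝ (harmonicMap h g) z v = deriv h z * v + conj (deriv g z * v) := by
  obtain ⟨e, he, hv⟩ := exists_hasFDerivAt_harmonicMap hh hg hz hlt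
  rw [he.fderiv, ← hv]
  rfl

theorem hasFDerivAt_two_mul_im {T : ℂ → ℂ} {T' z : ℂ} (hT : HasDerivAt T T' z) :
    ∃ L : ℂ →L[ℝ] ℝ, HasFDerivAt (fun z => (2 : ℝ) * (T z).im) L z ∧ ∀ v, L v = (2 : ℝ) * (T' * v).im := by
  have h1 := hT.hasFDerivAt.restrictScalars ℝ
  have h2 := (Complex.imCLM.hasFDerivAt.comp z h1).const_mul 2
  refine ⟨_, h2, fun v => ?_⟩
  simp [mul_comm]

/-- This is 2∂/∂z applied to F ∘ f = 2 Im T: on Re f it gives h' + g', on Im f it gives -i(h' - g'),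
and on 2 Im T it gives -2iT'. -/
theorem gradient_identity (hh : DifferentiableOn ℂ h disk)
    (hg : DifferentiableOn ℂ g disk) {z : ℂ} (hz : z ∈ disk)
    (hlt : ‖deriv g z‖ < ‖deriv h z‖) (hT : DifferentiableOn ℂ T disk)
    (hF : DifferentiableAt ℝ F (harmonicMap h g z))
    (hFT : ∀ z ∈ disk, F (harmonicMap h g z) = 2 * (T z).im) :
    ((partialX F (harmonicMap h g z) : ℝ) : ℂ) * (deriv h z + deriv g z) +
      ((partialY F (harmonicMap h g z) : ℝ) : ℂ) * (-Complex.I * (deriv h z - deriv g z)) =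
      -2 * Complex.I * deriv T z := by
  have hf := (contDiffAt_harmonicMap hh hg hz).differentiableAt (by simp)
  obtain ⟨L, hL, hLv⟩ := hasFDerivAt_two_mul_im (hT.hasDerivAt_disk hz)
  have h1 : HasFDerivAt (𝕜 := ℝ) (fun z => F (harmonicMap h g z)) L z := by
    refine hL.congr_of_eventuallyEq ?_
    filter_upwards [isOpen_disk.mem_nhds hz] with x hx
    exact hFT x hx
  have h2 := h1.unique (hF.hasFDerivAt.comp z hf.hasFDerivAt)
  have h3 : ∀ v, 2 * (deriv T z * v).im = fderiv ℝ F (harmonicMap h g z)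
      (deriv h z * v + conj (deriv g z * v)) := by
    intro v
    rw [← hLv, h2, ← fderiv_harmonicMap_apply hh hg hz hlt]
    rfl
  have e1 := h3 1
  have e2 := h3 Complex.I
  rw [fderiv_apply_eq_partial] at e1 e2
  simp at e1 e2
  apply Complex.ext
  · simp
    linarith
  · simp
    linarith

/-- Applying ∂/∂z̄ to the gradient identity kills the holomorphic factors and leaves a relation
between the second derivatives of F, to which `minimal_equation_of_gauss` applies with m = `G z` and
k = h'(z). -/
theorem isMinimalGraph_equation (hh : DifferentiableOn ℂ h disk)
    (hg : DifferentiableOn ℂ g disk)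
    (hlt : ∀ z ∈ disk, ‖deriv g z‖ < ‖deriv h z‖) (hT : DifferentiableOn ℂ T disk)
    (hG : ∀ z ∈ disk, ‖G z‖ < 1) (hgG : ∀ z ∈ disk, deriv g z = G z ^ 2 * deriv h z)
    (hTG : ∀ z ∈ disk, deriv T z = G z * deriv h z)
    (hF : ∀ w ∈ harmonicMap h g '' disk, ContDiffAt ℝ ∞ F w)
    (hFT : ∀ z ∈ disk, F (harmonicMap h g z) = 2 * (T z).im) :
    ∀ w ∈ harmonicMap h g '' disk,
    (1 + partialY F w ^ 2) * partialX (partialX F) w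
      - 2 * partialX F w * partialY F w * partialX (partialY F) w
      + (1 + partialX F w ^ 2) * partialY (partialY F) w = 0 := by
  rintro _ ⟨z, hz, rfl⟩
  set f := harmonicMap h g with hf
  have hFz := hF _ (mem_image_of_mem f hz)
  have hh0 : deriv h z ≠ 0 := norm_pos_iff.1 ((norm_nonneg _).trans_lt (hlt z hz))
  have hfd := (contDiffAt_harmonicMap hh hg hz).differentiableAt (by simp)
  have hA : deriv h z + deriv g z = (1 + G z ^ 2) * deriv h z := by rw [hgG z hz]; ring
  have hB : deriv h z - deriv g z = (1 - G z ^ 2) * deriv h z := by rw [hgG z hz]; ring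
  refine minimal_equation_of_gauss (hG z hz) hh0 ?_ ?_
  · have := gradient_identity hh hg hz (hlt z hz) hT (hFz.differentiableAt (by simp)) hFT
    rw [hA, hB, hTG z hz] at this
    exact this
  · rw [← hA, ← hB]
    have hp : DifferentiableAt ℝ (partialX F) (f z) :=
      (contDiffAt_partial hFz 1).differentiableAt (by simp)
    have hq : DifferentiableAt ℝ (partialY F) (f z) :=
      (contDiffAt_partial hFz Complex.I).differentiableAt (by simp)
    have hp' := (Complex.ofRealCLM.hasFDerivAt.comp z (hp.hasFDerivAt.comp z hfd.hasFDerivAt))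
    have hq' := (Complex.ofRealCLM.hasFDerivAt.comp z (hq.hasFDerivAt.comp z hfd.hasFDerivAt))
    have hh2 := (((hh.deriv isOpen_disk).hasDerivAt_disk hz).hasFDerivAt.restrictScalars ℝ)
    have hg2 := (((hg.deriv isOpen_disk).hasDerivAt_disk hz).hasFDerivAt.restrictScalars ℝ)
    have hT2 := (((hT.deriv isOpen_disk).hasDerivAt_disk hz).hasFDerivAt.restrictScalars ℝ)
    have hsum := (hp'.mul (hh2.add hg2)).add (hq'.mul ((hh2.sub hg2).const_mul (-Complex.I)))
    have hC := hT2.const_mul (-2 * Complex.I)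
    have heq := hsum.unique (hC.congr_of_eventuallyEq (by
      filter_upwards [isOpen_disk.mem_nhds hz] with x hx
      exact gradient_identity hh hg hx (hlt x hx) hT
        ((hF _ (mem_image_of_mem f hx)).differentiableAt (by simp)) hFT))
    have e1 := DFunLike.congr_fun heq 1
    have e2 := DFunLike.congr_fun heq Complex.I
    have hfz : ∀ v, fderiv ℝ f z v = deriv h z * v + conj (deriv g z * v) :=
      fun v => fderiv_harmonicMap_apply hh hg hz (hlt z hz) v
    simp [fderiv_apply_eq_partial, ← hf] at e1 e2
    rw [partialY_partialX hFz] at e1 e2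
    have k1 : ((fderiv ℝ f z 1).re : ℂ) + Complex.I * ((fderiv ℝ f z Complex.I).re : ℂ) =
        conj (deriv h z + deriv g z) := by
      rw [hfz, hfz]
      apply Complex.ext <;> simp
    have k2 : ((fderiv ℝ f z 1).im : ℂ) + Complex.I * ((fderiv ℝ f z Complex.I).im : ℂ) =
        conj (-Complex.I * (deriv h z - deriv g z)) := by
      rw [hfz, hfz]
      apply Complex.ext <;> simp <;> ring
    rw [← k1, ← k2]
    -- The combination `e1 + i e2` is 2∂/∂z̄; each second derivative of h, g, T enters with the
    -- factor 1 + i² = 0.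
    linear_combination e1 + Complex.I * e2 - (((partialX F (f z) : ℝ) : ℂ) * (deriv (deriv h) z +
      deriv (deriv g) z) - ((partialY F (f z) : ℝ) : ℂ) * Complex.I *
      (deriv (deriv h) z - deriv (deriv g) z)
      + 2 * Complex.I * deriv (deriv T) z) * Complex.I_sq

/-- A univalent harmonic mapping whose dilatation is the square of an analytic function lifts to
a minimal surface. -/
theorem isMinimalLift_harmonicMap (hh : DifferentiableOn ℂ h disk)
    (hg : DifferentiableOn ℂ g disk) (hinj : InjOn (harmonicMap h g) disk)
    (hlt : ∀ z ∈ disk, ‖deriv g z‖ < ‖deriv h z‖) (hT : DifferentiableOn ℂ T disk)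
    (hG : ∀ z ∈ disk, ‖G z‖ < 1) (hgG : ∀ z ∈ disk, deriv g z = G z ^ 2 * deriv h z)
    (hTG : ∀ z ∈ disk, deriv T z = G z * deriv h z) :
    ∃ F : ℂ → ℝ, (∀ z ∈ disk, F (harmonicMap h g z) = 2 * (T z).im) ∧
      IsMinimalLift (harmonicMap h g) F := by
  have hT2 : ∀ z ∈ disk, ContDiffAt ℝ ∞ (fun z => 2 * (T z).im) z := fun z hz =>
    contDiffAt_const.mul (Complex.imCLM.contDiff.contDiffAt.comp z (hT.contDiffAt_disk hz))
  set F : ℂ → ℝ := fun w => 2 * (T (Function.invFunOn (harmonicMap h g) disk w)).im with hFdef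
  have hinv : ∀ z ∈ disk, Function.invFunOn (harmonicMap h g) disk (harmonicMap h g z) = z :=
    fun z hz => hinj.leftInvOn_invFunOn hz
  have hFT : ∀ z ∈ disk, F (harmonicMap h g z) = 2 * (T z).im := by
    intro z hz
    rw [hFdef]
    simp only
    rw [hinv z hz]
  have hF : ∀ w ∈ harmonicMap h g '' disk, ContDiffAt ℝ ∞ F w := by
    rintro _ ⟨z, hz, rfl⟩
    refine ContDiffAt.comp (g := fun z => 2 * (T z).im) (harmonicMap h g z) ?_
      (contDiffAt_invFunOn_harmonicMap hh hg hinj hz (hlt z hz))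
    rw [hinv z hz]
    exact hT2 z hz
  refine ⟨F, hFT, ⟨isOpen_image_harmonicMap hh hg hlt, fun w hw => (hF w hw).contDiffWithinAt,
    isMinimalGraph_equation hh hg hlt hT hG hgG hTG hF hFT⟩, ?_⟩
  set X : ℂ → EuclideanSpace ℝ (Fin 3) := fun z =>
    !₂[(harmonicMap h g z).re, (harmonicMap h g z).im, F (harmonicMap h g z)] with hX
  have hXs : ∀ z ∈ disk, ContDiffAt ℝ ∞ X z := by
    intro z hz
    have hf := contDiffAt_harmonicMap hh hg hz
    rw [contDiffAt_euclidean]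
    intro i
    fin_cases i
    · exact Complex.reCLM.contDiff.contDiffAt.comp z hf
    · exact Complex.imCLM.contDiff.contDiffAt.comp z hf
    · exact (hF _ (mem_image_of_mem _ hz)).comp z hf
  have hcoord : ∀ z ∈ disk, ∀ v : ℂ,
      (fderiv ℝ X z v) 0 = ((deriv h z + deriv g z) * v).re ∧
      (fderiv ℝ X z v) 1 = (-Complex.I * (deriv h z - deriv g z) * v).re ∧
      (fderiv ℝ X z v) 2 = (-2 * Complex.I * deriv T z * v).re := by
    intro z hz v
    have hd := ((hXs z hz).differentiableAt (by simp)).hasFDerivAt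
    have hproj : ∀ i, HasFDerivAt (fun z => X z i)
        ((EuclideanSpace.proj i : EuclideanSpace ℝ (Fin 3) →L[ℝ] ℝ).comp (fderiv ℝ X z)) z :=
      fun i => (EuclideanSpace.proj i : EuclideanSpace ℝ (Fin 3) →L[ℝ] ℝ).hasFDerivAt.comp z hd
    have hf := ((contDiffAt_harmonicMap hh hg hz).differentiableAt (by simp)).hasFDerivAt
    have hfz := fderiv_harmonicMap_apply hh hg hz (hlt z hz) v
    obtain ⟨L, hL, hLv⟩ := hasFDerivAt_two_mul_im (hT.hasDerivAt_disk hz)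
    refine ⟨?_, ?_, ?_⟩
    · have := DFunLike.congr_fun ((hproj 0).unique (Complex.reCLM.hasFDerivAt.comp z hf)) v
      refine this.trans ?_
      simp [hfz]
      ring
    · have := DFunLike.congr_fun ((hproj 1).unique (Complex.imCLM.hasFDerivAt.comp z hf)) v
      refine this.trans ?_
      simp [hfz]
      ring
    · have h1 : HasFDerivAt (fun z => X z 2) L z := by
        refine hL.congr_of_eventuallyEq ?_
        filter_upwards [isOpen_disk.mem_nhds hz] with x hx
        exact hFT x hx
      have := DFunLike.congr_fun ((hproj 2).unique h1) v
      refine this.trans ?_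
      rw [hLv]
      simp
      ring
  -- The coordinates of 2∂X/∂z have vanishing sum of squares. The real part of this sum is ‖X_x‖² -
  -- ‖X_y‖² and the imaginary part is -2⟨X_x, X_y⟩, so both isothermal conditions follow.
  have hsq : ∀ z ∈ disk, (deriv h z + deriv g z) ^ 2 + (-Complex.I * (deriv h z - deriv g z)) ^ 2 +
      (-2 * Complex.I * deriv T z) ^ 2 = 0 := by
    intro z hz
    rw [hTG z hz, hgG z hz]
    linear_combination ((deriv h z - G z ^ 2 * deriv h z) ^ 2 + 4 * (G z * deriv h z) ^ 2) *
      Complex.I_sq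
  have hnorm : ∀ z ∈ disk, ‖partialX X z‖ = ‖partialY X z‖ := by
    intro z hz
    obtain ⟨a0, a1, a2⟩ := hcoord z hz 1
    obtain ⟨b0, b1, b2⟩ := hcoord z hz Complex.I
    have e := congrArg Complex.re (hsq z hz)
    rw [EuclideanSpace.norm_eq, EuclideanSpace.norm_eq]
    congr 1
    simp only [partialX, partialY, Fin.sum_univ_three, Real.norm_eq_abs, sq_abs, a0, a1, a2, b0,
      b1, b2]
    generalize deriv h z + deriv g z = A at *
    generalize -Complex.I * (deriv h z - deriv g z) = B at *
    generalize -2 * Complex.I * deriv T z = C at *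
    simp [pow_two] at e ⊢
    linarith
  refine ⟨fun z hz => (hXs z hz).contDiffWithinAt, fun z hz h0 => ?_, hnorm, fun z hz => ?_⟩
  · have h1 : partialY X z = 0 := by rw [← norm_eq_zero, ← hnorm z hz, h0, norm_zero]
    obtain ⟨a0, a1, -⟩ := hcoord z hz 1
    obtain ⟨b0, b1, -⟩ := hcoord z hz Complex.I
    have a : fderiv ℝ X z 1 = 0 := h0
    have b : fderiv ℝ X z Complex.I = 0 := h1
    rw [a] at a0 a1
    rw [b] at b0 b1
    simp at a0 a1 b0 b1
    -- If both partial derivatives vanish, the first two coordinates give h' + g' = 0 and h' - g' =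
    -- 0, contradicting ‖g'‖ < ‖h'‖.
    have hz0 : deriv h z = 0 := by
      apply Complex.ext
      · simp; linarith
      · simp; linarith
    have := hlt z hz
    rw [hz0, norm_zero] at this
    exact (norm_nonneg _).not_gt this
  · obtain ⟨a0, a1, a2⟩ := hcoord z hz 1
    obtain ⟨b0, b1, b2⟩ := hcoord z hz Complex.I
    have e := congrArg Complex.im (hsq z hz)
    rw [PiLp.inner_apply]
    simp only [partialX, partialY, Fin.sum_univ_three, a0, a1, a2, b0, b1, b2]
    generalize deriv h z + deriv g z = A at *
    generalize -Complex.I * (deriv h z - deriv g z) = B at *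
    generalize -2 * Complex.I * deriv T z = C at *
    simp [pow_two] at e ⊢
    linarith

end

end

/-! ### Assembly of the theorem. -/

theorem theorem3p3 (n : ℕ) (hn : 1 ≤ n) :
    -- the shears exist
    (∀ c ∈ Icc (0 : ℝ) 2, ∃ h g : ℂ → ℂ, IsShear (koebe c) (fun z => z ^ n) h g) ∧
    ∀ h g : ℝ → ℂ → ℂ,
      (∀ c ∈ Icc (0 : ℝ) 2, IsShear (koebe c) (fun z => z ^ n) (h c) (g c)) →
      -- they are in the class `S_H^0` and their ranges are convex in the horizontal direction
      (∀ c ∈ Icc (0 : ℝ) 2,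
        IsSH0 (h c) (g c) ∧ IsCHD (harmonicMap (h c) (g c) '' disk)) ∧
      -- they depend continuously on `c`
      ContinuousOn (fun p : ℝ × ℂ => harmonicMap (h p.1) (g p.1) p.2) (Icc (0 : ℝ) 2 ×ˢ disk) ∧
      -- the range is a strip or a half-strip, then a wave plane, then a slit domain
      (Even n → harmonicMap (h 0) (g 0) '' disk = strip) ∧
      (Odd n → ∃ a : ℝ, harmonicMap (h 0) (g 0) '' disk = halfStrip a) ∧
      (∀ c ∈ Ioo (0 : ℝ) 2,
        IsWavePlane (waveHeights c n) (harmonicMap (h c) (g c) '' disk)) ∧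
      (∃ a : ℝ, harmonicMap (h 2) (g 2) '' disk = slitDomain a) ∧
      -- the mappings lift to minimal surfaces if `n` is even
      (Even n → ∀ c ∈ Icc (0 : ℝ) 2, ∃ (F : ℂ → ℝ) (T : ℂ → ℂ),
        DifferentiableOn ℂ T disk ∧ T 0 = 0 ∧
        (∀ z ∈ disk, deriv T z = z ^ (n / 2) * deriv (h c) z) ∧
        (∀ z ∈ disk, F (harmonicMap (h c) (g c) z) = 2 * (T z).im) ∧
        IsMinimalLift (harmonicMap (h c) (g c)) F) := by
  have h02 : (0 : ℝ) ∈ Icc (0 : ℝ) 2 := by simp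
  have h22 : (2 : ℝ) ∈ Icc (0 : ℝ) 2 := by simp
  refine ⟨fun c _ => exists_isShear hn c, fun h g H => ⟨fun c hc =>
    ⟨(H c hc).isSH0 hn hc, (H c hc).isCHD hn hc⟩, continuousOn_harmonicMap hn H, fun he => ?_,
    fun ho => ?_, fun c hc => ?_, ?_, fun he c hc => ?_⟩⟩
  · rw [(H 0 h02).image_eq]
    exact ((H 0 h02).isShearSum hn).image_eq_strip hn he
  · rw [(H 0 h02).image_eq]
    exact ((H 0 h02).isShearSum hn).image_eq_halfStrip hn ho
  · have hc' := Ioo_subset_Icc_self hc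
    rw [(H c hc').image_eq]
    exact ((H c hc').isShearSum hn).isWavePlane hc hn
  · rw [(H 2 h22).image_eq]
    exact ((H 2 h22).isShearSum hn).image_eq_slitDomain hn
  · have Hc := H c hc
    have hn2 : n / 2 * 2 = n := Nat.div_mul_cancel he.two_dvd
    -- A positive exponent is needed for |z^(n/2)| < 1, the strict bound on the Gauss map.
    have hn1 : 1 ≤ n / 2 := by omega
    obtain ⟨T, hT0, hT⟩ := exists_primitive (f := fun z => z ^ (n / 2) * deriv (h c) z)
      ((differentiableOn_id.pow _).mul (Hc.analytic_h.deriv isOpen_disk))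
    have hTd : DifferentiableOn ℂ T disk :=
      fun z hz => (hT z hz).differentiableAt.differentiableWithinAt
    obtain ⟨F, hFT, hF⟩ := isMinimalLift_harmonicMap (G := fun z => z ^ (n / 2)) Hc.analytic_h
      Hc.analytic_g (Hc.isSH0 hn hc).univalent (fun z hz => Hc.norm_deriv_lt hn hz) hTd
      (fun z hz => mem_disk.1 (pow_mem_disk hn1 hz))
      (fun z hz => by rw [← pow_mul, hn2]; exact Hc.dilatation z hz)
      (fun z hz => (hT z hz).deriv)
    exact ⟨F, T, hTd, hT0, fun z hz => (hT z hz).deriv, hFT, hF⟩
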